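/- Let $n_1,n_2,n\in\mathbb N$ with $n_1+n_2\le n$, let $\emptyset\ne\mathcal J(i)\subseteq\{1,\dots,n\}$ for $1\le i\le n_1+n_2$, and let $q_k\in\mathbb R^n$, $b_k\in\mathbb R$ for $n_1+n_2<k\le n$. A vector $x\in\mathbb R^n$ is a feasible solution of the associated system of linear equations with min and max operators (LEMM) if $$x_i=\min_{l\in\mathcal J(i)}x_l\ (1\le i\le n_1),\qquad x_j=\max_{l\in\mathcal J(j)}x_l\ (n_1<j\le n_1+n_2),\qquad x_k=q_k^{\mathsf T}x+b_k\ (n_1+n_2<k\le n).$$ For every choice function $\ell$ with $\ell(i)\in\mathcal J(i)$ for $1\le i\le n_1+n_2$, let $Q_\ell$ be the $n\times n$ matrix whose $i$-th row is the unit vector $e_{\ell(i)}^{\mathsf T}$ for $i\le n_1+n_2$ and $q_i^{\mathsf T}$ for $i>n_1+n_2$. The LEMM satisfies condition C1 if $\lim_{m\to\infty}Q^m=0$ for every $Q$ in the convex hull of the matrices $Q_\ell$. The LEMM decision problem under C1 is the following promise problem: given an LEMM with rational data that satisfies C1, an index $i\in\{1,\dots,n\}$ and a rational threshold $\beta$ (rational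 numbers being written in binary), decide whether there is a feasible solution $x$ with $x_i<\beta$. A promise problem is in UP if there is a verifier, running in polynomial time on a Turing machine, which for every instance satisfying the promise accepts exactly one certificate, of length polynomially bounded in the size of the instance, if the answer is Yes, and accepts no certificate if the answer is No; it is in coUP if the problem with the answers Yes and No exchanged is in UP. **Theorem.** Every LEMM satisfying C1 has exactly one feasible solution, and the LEMM decision problem under C1 is in $\mathrm{UP}\cap\mathrm{coUP}$. -/

import Mathlib

open Filter Topology

/-- Data `(n₁, n₂, n, J, q, b)` of a system of linear equations with min and max operators, with
coefficients in `R`. Variables are indexed from `0`: those with index `< n₁` are the min variables,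
those with index in `[n₁, n₁ + n₂)` the max variables, the remaining ones the affine variables.
`J` is given for min and max variables only, `q` and `b` for affine variables only. -/
structure LEMM (R : Type) where
  n₁ : ℕ
  n₂ : ℕ
  n : ℕ
  le_n : n₁ + n₂ ≤ n
  J : ∀ i : Fin n, (i : ℕ) < n₁ + n₂ → Finset (Fin n)
  J_nonempty : ∀ i h, (J i h).Nonempty
  q : ∀ k : Fin n, n₁ + n₂ ≤ (k : ℕ) → Fin n → R
  b : ∀ k : Fin n, n₁ + n₂ ≤ (k : ℕ) → R

namespace LEMM

/-- A rational system, regarded as a real one. -/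
noncomputable def toReal (L : LEMM ℚ) : LEMM ℝ where
  n₁ := L.n₁
  n₂ := L.n₂
  n := L.n
  le_n := L.le_n
  J := L.J
  J_nonempty := L.J_nonempty
  q := fun k h l => (L.q k h l : ℝ)
  b := fun k h => (L.b k h : ℝ)

/-- `x` is a feasible solution of the system. -/
def IsFeasible (L : LEMM ℝ) (x : Fin L.n → ℝ) : Prop :=
  (∀ (i : Fin L.n) (h : (i : ℕ) < L.n₁),
    x i = (L.J i (Nat.lt_add_right L.n₂ h)).inf' (L.J_nonempty i _) x) ∧
  (∀ (j : Fin L.n) (_ : L.n₁ ≤ (j : ℕ)) (h : (j : ℕ) < L.n₁ + L.n₂),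
    x j = (L.J j h).sup' (L.J_nonempty j h) x) ∧
  (∀ (k : Fin L.n) (h : L.n₁ + L.n₂ ≤ (k : ℕ)),
    x k = ∑ l, L.q k h l * x l + L.b k h)

/-- The matrix of the linear system obtained by replacing the equation of every min or max
variable `x i` by `x i = x (ℓ i)`. -/
def choiceMatrix (L : LEMM ℝ) (ℓ : ∀ i : Fin L.n, (i : ℕ) < L.n₁ + L.n₂ → Fin L.n) :
    Matrix (Fin L.n) (Fin L.n) ℝ :=
  Matrix.of fun i j =>
    if h : (i : ℕ) < L.n₁ + L.n₂ then (if j = ℓ i h then 1 else 0)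
    else L.q i (not_lt.mp h) j

/-- The set of all matrices obtained from a choice `ℓ i ∈ J i` for each min or max variable. -/
def choiceMatrices (L : LEMM ℝ) : Set (Matrix (Fin L.n) (Fin L.n) ℝ) :=
  {Q | ∃ ℓ : ∀ i : Fin L.n, (i : ℕ) < L.n₁ + L.n₂ → Fin L.n,
    (∀ i h, ℓ i h ∈ L.J i h) ∧ Q = L.choiceMatrix ℓ}

/-- The halting (stability) condition C1. -/
def Halting (L : LEMM ℝ) : Prop :=
  ∀ Q ∈ convexHull ℝ L.choiceMatrices, Tendsto (fun m : ℕ => Q ^ m) atTop (𝓝 0)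

end LEMM

/-- An input of the LEMM decision problem: a rational system, an index, a rational threshold. -/
structure LEMMInstance where
  L : LEMM ℚ
  i : Fin L.n
  β : ℚ

/-- The finite alphabet in which inputs and certificates are written. -/
inductive LEMMSymbol
  | bit (value : Bool)
  | minus
  | slash
  | sep

namespace LEMMInstance

open LEMMSymbol

/-- Unary notation, used for `n₁`, `n₂`, `n` and the index `i` only: all are at most `n`, and the
`n` equations are listed one by one anyway. -/
def encodeUnary (m : ℕ) : List LEMMSymbol :=
  List.replicate m (bit true) ++ [sep]

/-- A rational number in lowest terms: sign, numerator and denominator in binary, least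
significant bit first. -/
def encodeRat (r : ℚ) : List LEMMSymbol :=
  (if r < 0 then [minus] else []) ++ r.num.natAbs.bits.map bit ++ [slash] ++
    r.den.bits.map bit ++ [sep]

/-- The equation number `r`: the membership bits of `J r` for a min or max variable, the
coefficients `q r` followed by `b r` for an affine variable. -/
def encodeRow (L : LEMM ℚ) (r : Fin L.n) : List LEMMSymbol :=
  if h : (r : ℕ) < L.n₁ + L.n₂ then
    ((List.finRange L.n).map fun l => bit (decide (l ∈ L.J r h))) ++ [sep]
  else
    ((List.finRange L.n).flatMap fun l => encodeRat (L.q r (not_lt.mp h) l)) ++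
      encodeRat (L.b r (not_lt.mp h))

/-- The input string of the decision problem. -/
def encode (I : LEMMInstance) : List LEMMSymbol :=
  encodeUnary I.L.n₁ ++ encodeUnary I.L.n₂ ++ encodeUnary I.L.n ++ encodeUnary I.i ++
    encodeRat I.β ++ (List.finRange I.L.n).flatMap (encodeRow I.L)

end LEMMInstance

/-- A decision problem restricted to the instances that satisfy a promise. -/
structure PromiseProblem where
  Inst : Type
  Alphabet : Type
  encode : Inst → List Alphabet
  promise : Inst → Prop
  yes : Inst → Prop

namespace PromiseProblem

/-- The problem with the answers Yes and No exchanged (and the same promise). -/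
def compl (P : PromiseProblem) : PromiseProblem where
  Inst := P.Inst
  Alphabet := P.Alphabet
  encode := P.encode
  promise := P.promise
  yes := fun I => ¬ P.yes I

/-- An instance and a certificate, written one after the other with a separating symbol `none`. -/
def encodePair (P : PromiseProblem) (a : P.Inst × List P.Alphabet) : List (Option P.Alphabet) :=
  (P.encode a.1).map some ++ none :: a.2.map some

/-- The class UP: there is a verifier `V`, computed by a Turing machine in polynomial time, such
that on the instances satisfying the promise, `V` accepts exactly one certificate, of polynomially
bounded length, if the answer is Yes, and no certificate if the answer is No. -/
def InUP (P : PromiseProblem) : Prop :=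
  ∃ (V : P.Inst × List P.Alphabet → Bool) (p : Polynomial ℕ),
    Nonempty (Turing.TM2ComputableInPolyTime P.encodePair Computability.encodeBool V) ∧
    ∀ I : P.Inst, P.promise I →
      (P.yes I → ∃ w : List P.Alphabet, w.length ≤ p.eval (P.encode I).length ∧
        ∀ w', V (I, w') = true ↔ w' = w) ∧
      (¬ P.yes I → ∀ w, V (I, w) = false)

/-- The class coUP. -/
def InCoUP (P : PromiseProblem) : Prop :=
  P.compl.InUP

end PromiseProblem

/-- The LEMM decision problem under condition C1: given a rational system satisfying C1, an index
`i` and a rational threshold `β`, is there a feasible solution `x` with `x i < β`? -/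
def lemmHaltingProblem : PromiseProblem where
  Inst := LEMMInstance
  Alphabet := LEMMSymbol
  encode := LEMMInstance.encode
  promise := fun I => I.L.toReal.Halting
  yes := fun I => ∃ x : Fin I.L.n → ℝ, I.L.toReal.IsFeasible x ∧ x I.i < (I.β : ℝ)

/-! For vectors x and y, each coordinate of the difference of the right-hand sides equals w·(x - y)
for some w in the convex hull of the admissible rows. Since rows are chosen independently, the whole
difference is Q(x - y) for a single Q in the hull of the choice matrices (`LEMM.exists_mulVec`).
Under C1 a vector v = tQv with 0 ≤ t ≤ 1 vanishes, because v = t^m Q^m v → 0; compactness turns this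
into ‖v - tQv‖ ≥ c‖v‖ with one c for all t and Q (`LEMM.exists_lower_bound`). At t = 1 this gives
uniqueness. Existence is by continuation: x = t·rhs(x) + a is trivially solvable at t = 0, and
solvability for all a passes from t to t + s by a contraction argument, with a step length
independent of t (`LEMM.solvable_step`), so t = 1 is reached.

The solution of a rational system also solves the linear system of a choice attaining every min and
max. The matrix I - Q of that system is invertible by C1, and Cramer's rule bounds numerators and
denominators to polynomially many bits (`LEMM.exists_rat_solution`). The certificate is this vector,
both for Yes and for No: the verifier tests the equations and compares one coordinate with the
threshold, and never has to check the promise. Uniqueness of the certificate as a string requires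
fractions in lowest terms. Instead of computing a gcd, the verifier reads numbers u, v with uN + 1 =
vd, which are unique once u < d (`canonical_injective`), and it re-encodes what it has read to
exclude other spellings (`verify_iff`).

Polynomial time is proved compositionally. Structured programs compile to `TM2` machines with the
same running time (`Exec.run_compile`). The functions on tree-coded data computed by three-stack
programs in polynomial time (`PT`) are closed under composition, pairing, case distinction and folds
whose state grows by a controlled amount per step (`PT.foldl`). The verifier is assembled from
these, and `PT.nonempty_tm2` yields the machine. -/

/-! ### Structured stack programs and their compilation to Turing machines -/

/-- Structured programs acting on stacks indexed by `K` with symbols in `G`. -/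
inductive StackProg (K G : Type)
  | skip
  | push (k : K) (a : G)
  | seq (c d : StackProg K G)
  | popCase (k : K) (f : Option G → StackProg K G)
  | loop (k : K) (p : Option G → Bool) (c : StackProg K G)

namespace StackProg

open Function (update)
open Turing

variable {K G : Type}

/-- `Exec c S t S'`: the program `c` transforms the stacks `S` into `S'` in time `t`. -/
inductive Exec [DecidableEq K] : StackProg K G → (K → List G) → ℕ → (K → List G) → Prop
  | skip (S) : Exec skip S 1 S
  | push (k a S) : Exec (push k a) S 1 (update S k (a :: S k))
  | seq {c d S₁ t₁ S₂ t₂ S₃} : Exec c S₁ t₁ S₂ → Exec d S₂ t₂ S₃ → Exec (seq c d) S₁ (t₁ + t₂) S₃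
  | popCase {k f S t S'} : Exec (f (S k).head?) (update S k (S k).tail) t S' →
      Exec (popCase k f) S (t + 1) S'
  | loop_done {k p c S} : p (S k).head? = false → Exec (loop k p c) S 1 S
  | loop_step {k p c S₁ t₁ S₂ t₂ S₃} : p (S₁ k).head? = true → Exec c S₁ t₁ S₂ →
      Exec (loop k p c) S₂ t₂ S₃ → Exec (loop k p c) S₁ (t₁ + t₂ + 1) S₃

/-- The program positions, used as labels of the machine executing the program. -/
def Lab : StackProg K G → Type
  | skip => Unit
  | push _ _ => Unit
  | seq c d => Lab c ⊕ Lab d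
  | popCase _ f => Option (Σ o, Lab (f o))
  | loop _ _ c => Option (Lab c)

theorem finite_lab [Finite G] (c : StackProg K G) : Finite c.Lab := by
  induction c with
  | skip => exact inferInstanceAs (Finite Unit)
  | push => exact inferInstanceAs (Finite Unit)
  | seq c d hc hd => exact inferInstanceAs (Finite (Lab c ⊕ Lab d))
  | popCase k f hf => exact inferInstanceAs (Finite (Option (Σ o, Lab (f o))))
  | loop k p c hc => exact inferInstanceAs (Finite (Option (Lab c)))

/-- The position at which the execution starts. -/
def entry : (c : StackProg K G) → c.Lab
  | skip => ()
  | push _ _ => ()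
  | seq c _ => Sum.inl c.entry
  | popCase _ _ => none
  | loop _ _ _ => none

/-- The stack alphabets of the machine: an output stack of booleans and the stacks of the program. -/
abbrev Sym (K G : Type) : Option K → Type
  | none => Bool
  | some _ => G

/-- The stacks of the machine, for an empty output stack. -/
def withOutput (S : K → List G) : ∀ k, List (Sym K G k)
  | none => []
  | some k => S k

theorem update_withOutput [DecidableEq K] (S : K → List G) (k : K) (l : List G) :
    update (withOutput S) (some k) l = withOutput (update S k l) := by
  funext j
  cases j with
  | none => exact Function.update_of_ne (by simp) _ _
  | some j =>
    by_cases h : j = k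
    · subst h
      exact (Function.update_self _ _ _).trans (Function.update_self j l S).symm
    · have h₁ : update S k l j = S j := Function.update_of_ne h l S
      have h₂ : update (withOutput S) (some k) l (some j) = withOutput S (some j) :=
        Function.update_of_ne (by simpa using h) _ _
      exact h₂.trans h₁.symm

/-- The machine code of a program, where `emb` places the positions of the program among the labels
of the machine, and `exit` is the label to jump to after the execution. -/
def compile {Λ : Type} : (c : StackProg K G) → (c.Lab → Λ) → Λ → c.Lab →
    TM2.Stmt (Sym K G) Λ (Option G)
  | skip, _, exit, _ => .goto fun _ => exit
  | push k a, _, exit, _ => .push (some k) (fun _ => a) (.goto fun _ => exit)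
  | seq c d, emb, exit, l => match l with
    | Sum.inl l => c.compile (fun l => emb (Sum.inl l)) (emb (Sum.inr d.entry)) l
    | Sum.inr l => d.compile (fun l => emb (Sum.inr l)) exit l
  | popCase k f, emb, exit, l => match l with
    | none => .pop (some k) (fun _ o => o) (.goto fun o => emb (some ⟨o, (f o).entry⟩))
    | some ⟨o, l⟩ => (f o).compile (fun l => emb (some ⟨o, l⟩)) exit l
  | loop k p c, emb, exit, l => match l with
    | none => .peek (some k) (fun _ o => o)
        (.branch p (.goto fun _ => emb (some c.entry)) (.goto fun _ => exit))
    | some l => c.compile (fun l => emb (some l)) (emb none) l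

/-- The iterated step function of a machine. -/
def run [DecidableEq K] {Λ : Type} (M : Λ → TM2.Stmt (Sym K G) Λ (Option G)) (t : ℕ)
    (a : TM2.Cfg (Sym K G) Λ (Option G)) : Option (TM2.Cfg (Sym K G) Λ (Option G)) :=
  (flip Bind.bind (TM2.step M))^[t] (some a)

theorem run_add [DecidableEq K] {Λ : Type} {M : Λ → TM2.Stmt (Sym K G) Λ (Option G)} {s t : ℕ}
    {a b : TM2.Cfg (Sym K G) Λ (Option G)} (h : run M s a = some b) :
    run M (s + t) a = run M t b := by
  unfold run at *
  rw [add_comm, Function.iterate_add_apply, h]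

theorem run_one [DecidableEq K] {Λ : Type} (M : Λ → TM2.Stmt (Sym K G) Λ (Option G)) (l : Λ) (v S) :
    run M 1 ⟨some l, v, S⟩ = some (TM2.stepAux (M l) v S) := rfl

/-- Induction on the execution; each unit of `Exec` time is one machine step. The machine is
constrained only on the labels in the image of `emb`, so the statement applies to subprograms placed
inside a larger machine. The register `v` may be arbitrary on entry, since every test is preceded by
a read that overwrites it. -/
theorem Exec.run_compile [DecidableEq K] {c : StackProg K G} {S S' : K → List G} {t : ℕ} (h : Exec c S t S')
    {Λ : Type} (M : Λ → TM2.Stmt (Sym K G) Λ (Option G)) (emb : c.Lab → Λ) (exit : Λ)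
    (hM : ∀ l, M (emb l) = c.compile emb exit l) (v : Option G) :
    ∃ v', run M t ⟨some (emb c.entry), v, withOutput S⟩ = some ⟨some exit, v', withOutput S'⟩ := by
  induction h generalizing exit v with
  | skip S => exact ⟨v, by rw [run_one, hM]; rfl⟩
  | push k a S =>
    refine ⟨v, ?_⟩
    rw [run_one, hM]
    exact congrArg (fun T => some (TM2.Cfg.mk (some exit) v T)) (update_withOutput S k _)
  | @seq c d S₁ t₁ S₂ t₂ S₃ _ _ hc hd =>
    obtain ⟨v₁, h₁⟩ := hc (fun l => emb (Sum.inl l)) (emb (Sum.inr d.entry))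
      (fun l => hM (Sum.inl l)) v
    obtain ⟨v₂, h₂⟩ := hd (fun l => emb (Sum.inr l)) exit (fun l => hM (Sum.inr l)) v₁
    exact ⟨v₂, (run_add h₁).trans h₂⟩
  | @popCase k f S t S' _ hf =>
    obtain ⟨v₁, h₁⟩ := hf (fun l => emb (some ⟨(S k).head?, l⟩)) exit
      (fun l => hM (some ⟨_, l⟩)) (S k).head?
    refine ⟨v₁, ?_⟩
    rw [add_comm]
    refine (run_add ?_).trans h₁
    rw [run_one, hM]
    exact congrArg (fun T => some (TM2.Cfg.mk _ (S k).head? T)) (update_withOutput S k _)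
  | @loop_done k p c S hp =>
    refine ⟨(S k).head?, ?_⟩
    rw [run_one, hM]
    simp only [compile, entry, TM2.stepAux]
    have : p (withOutput S (some k)).head? = false := hp
    rw [this]; rfl
  | @loop_step k p c S₁ t₁ S₂ t₂ S₃ hp _ _ hc hl =>
    obtain ⟨v₁, h₁⟩ := hc (fun l => emb (some l)) (emb none) (fun l => hM (some l)) (S₁ k).head?
    obtain ⟨v₂, h₂⟩ := hl emb exit hM v₁
    refine ⟨v₂, ?_⟩
    rw [add_comm]
    refine (run_add (b := ⟨some (emb (some c.entry)), (S₁ k).head?, withOutput S₁⟩) ?_).trans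
      ((run_add h₁).trans h₂)
    rw [run_one, hM]
    simp only [compile, entry, TM2.stepAux]
    have : p (withOutput S₁ (some k)).head? = true := hp
    rw [this]; rfl

end StackProg

/-! ### Trees on stacks: moving, deleting and copying -/

/-- Binary trees, the data on which polynomial time programs operate. -/
inductive Dat
  | nil
  | cons (a b : Dat)

/-- The symbols on the stacks of the verifier. -/
abbrev Cell := Option LEMMSymbol

namespace PolyProg

open Function (update)
open StackProg

/-- Programs with three stacks: the data stack `0` and the auxiliary stacks `1` and `2`. -/
abbrev Prog := StackProg (Fin 3) Cell

/-- The symbol for an inner node. -/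
abbrev symT : Cell := some (.bit true)

/-- The symbol for a leaf. -/
abbrev symF : Cell := some (.bit false)

/-- The delimiter on auxiliary stacks. -/
abbrev symM : Cell := none

/-- The Polish-notation code of a tree. -/
def code : Dat → List Cell
  | .nil => [symF]
  | .cons a b => symT :: (code a ++ code b)

/-- The contents of the three stacks. -/
def st (a b c : List Cell) : Fin 3 → List Cell := ![a, b, c]

@[simp] theorem st_zero (a b c) : st a b c 0 = a := rfl
@[simp] theorem st_one (a b c) : st a b c 1 = b := rfl
@[simp] theorem st_two (a b c) : st a b c 2 = c := rfl

@[simp] theorem update_st_zero (a b c l) : update (st a b c) 0 l = st l b c := by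
  funext i; fin_cases i <;> rfl

@[simp] theorem update_st_one (a b c l) : update (st a b c) 1 l = st a l c := by
  funext i; fin_cases i <;> rfl

@[simp] theorem update_st_two (a b c l) : update (st a b c) 2 l = st a b l := by
  funext i; fin_cases i <;> rfl

/-- The program `c` transforms the stacks `S` into `S'` in time at most `n`. -/
def Runs (c : Prog) (n : ℕ) (S S' : Fin 3 → List Cell) : Prop :=
  ∃ t ≤ n, Exec c S t S'

theorem Runs.mono {c : Prog} {m n : ℕ} {S S'} (h : Runs c m S S') (hmn : m ≤ n) :
    Runs c n S S' := by
  obtain ⟨t, ht, h⟩ := h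
  exact ⟨t, ht.trans hmn, h⟩

theorem Runs.skip (S) : Runs .skip 1 S S := ⟨1, le_rfl, .skip S⟩

theorem Runs.push (k a S) : Runs (.push k a) 1 S (update S k (a :: S k)) :=
  ⟨1, le_rfl, .push k a S⟩

theorem Runs.seq {c d : Prog} {m n : ℕ} {S₁ S₂ S₃} (h₁ : Runs c m S₁ S₂) (h₂ : Runs d n S₂ S₃) :
    Runs (.seq c d) (m + n) S₁ S₃ := by
  obtain ⟨s, hs, h₁⟩ := h₁
  obtain ⟨t, ht, h₂⟩ := h₂
  exact ⟨s + t, add_le_add hs ht, .seq h₁ h₂⟩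

theorem Runs.popCase {k f n S S'} (h : Runs (f (S k).head?) n (update S k (S k).tail) S') :
    Runs (.popCase k f) (n + 1) S S' := by
  obtain ⟨t, ht, h⟩ := h
  exact ⟨t + 1, by lia, .popCase h⟩

theorem Runs.loop_done {k p c S} (h : p (S k).head? = false) : Runs (.loop k p c) 1 S S :=
  ⟨1, le_rfl, .loop_done h⟩

theorem Runs.loop_step {k p c m n S₁ S₂ S₃} (h : p (S₁ k).head? = true)
    (h₁ : Runs c m S₁ S₂) (h₂ : Runs (.loop k p c) n S₂ S₃) :
    Runs (.loop k p c) (m + n + 1) S₁ S₃ := by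
  obtain ⟨s, hs, h₁⟩ := h₁
  obtain ⟨t, ht, h₂⟩ := h₂
  exact ⟨s + t + 1, by lia, .loop_step h h₁ h₂⟩

/-- Tests for the symbol of an inner node. -/
def isT : Option Cell → Bool
  | some (some (.bit true)) => true
  | _ => false

/-- Tests for a symbol of the code of a tree. -/
def isBit : Option Cell → Bool
  | some (some (.bit _)) => true
  | _ => false

/-- Removes the top symbol of a stack. -/
def pop (k : Fin 3) : Prog := .popCase k fun _ => .skip

theorem runs_pop (k S) : Runs (pop k) 2 S (update S k (S k).tail) :=
  .popCase (.skip _)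

/-- Pushes a symbol that was read. -/
def pushOpt (k : Fin 3) : Option Cell → Prog
  | some a => .push k a
  | none => .skip

/-- Moves symbols from one stack to another one. -/
def transfer (j k : Fin 3) : Prog := .loop j isBit (.popCase j (pushOpt k))

/-- The delimiter `symM` fails the test `isBit`, so it stops the loop without any counter. The
factor 3 counts the test, the pop and the push for each symbol. -/
theorem runs_transfer {j k : Fin 3} (hjk : j ≠ k) (u x : List Cell)
    (hu : ∀ a ∈ u, isBit (some a) = true) (S : Fin 3 → List Cell) (hS : S j = u ++ symM :: x) :
    Runs (transfer j k) (3 * u.length + 1) S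
      (update (update S j (symM :: x)) k (u.reverse ++ S k)) := by
  induction u generalizing S with
  | nil =>
    have : update (update S j (symM :: x)) k ([].reverse ++ S k) = S := by
      rw [List.nil_append] at hS
      rw [← hS, Function.update_eq_self]
      exact Function.update_eq_self k S
    rw [this]
    exact .loop_done (by rw [hS]; rfl)
  | cons a u ih =>
    have h := ih (fun b hb => hu b (List.mem_cons_of_mem _ hb))
      (update (update S j (u ++ symM :: x)) k (a :: S k))
      (by rw [Function.update_of_ne hjk, Function.update_self])
    have hstep : Runs (.popCase j (pushOpt k)) 2 S
        (update (update S j (u ++ symM :: x)) k (a :: S k)) := by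
      refine .popCase ?_
      rw [hS]
      have := Runs.push k a (update S j (u ++ symM :: x))
      rw [Function.update_of_ne hjk.symm] at this
      exact this
    refine (Runs.loop_step (by rw [hS]; exact hu a (by simp)) hstep h).mono
      (by simp; lia) |> cast (congrArg _ ?_)
    rw [Function.update_self, Function.update_comm hjk.symm, Function.update_idem,
      Function.update_idem]
    simp

theorem isBit_of_mem_code {t : Dat} {a : Cell} (h : a ∈ code t) : isBit (some a) = true := by
  induction t with
  | nil => simp only [code, List.mem_singleton] at h; subst h; rfl
  | cons s t hs ht =>
    simp only [code, List.mem_cons, List.mem_append] at h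
    rcases h with rfl | h | h
    · rfl
    · exact hs h
    · exact ht h

/-- The loop of `unload`. -/
def unloadLoop : Prog :=
  .loop 2 isT (.popCase 0 fun o => match o with
    | some (some (.bit true)) => .seq (.push 1 symT) (.push 2 symT)
    | some (some (.bit false)) => .seq (.push 1 symF) (pop 2)
    | _ => .skip)

/-- Stack `2` holds one `symT` for each subtree still to be read: an inner node replaces one pending
tree by two, a leaf removes one. The continuation form, in which the rest of the run is a
hypothesis, lets the run for the left subtree hand over to the run for the right one. -/
theorem runs_unloadLoop (t : Dat) (r b c : List Cell) {n : ℕ} {S'}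
    (h : Runs unloadLoop n (st r ((code t).reverse ++ b) c) S') :
    Runs unloadLoop (n + 5 * (code t).length) (st (code t ++ r) b (symT :: c)) S' := by
  induction t generalizing r b c n with
  | nil =>
    refine (Runs.loop_step (m := 4) rfl (.popCase (.seq (.push _ _ _) (runs_pop _ _)))
      (n := n) ?_).mono ?_
    · change Runs unloadLoop _ _ _
      simpa [code] using h
    · simp [code]; lia
  | cons s t hs ht =>
    have h₁ := hs (code t ++ r) (symT :: b) (symT :: c)
      (ht r ((code s).reverse ++ symT :: b) c (n := n) (by simpa [code] using h))
    refine (Runs.loop_step (m := 3) rfl (.popCase (.seq (.push _ _ _) (.push _ _ _)))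
      (n := n + 5 * (code t).length + 5 * (code s).length) ?_).mono ?_
    · change Runs unloadLoop _ _ _
      simpa [code] using h₁
    · simp [code]; lia

/-- Moves the top tree of the data stack to stack `1`. -/
def unload : Prog :=
  .seq (.push 1 symM) (.seq (.push 2 symM) (.seq (.push 2 symT) (.seq unloadLoop (pop 2))))

theorem runs_unload (t : Dat) (r b c : List Cell) :
    Runs unload (5 * (code t).length + 6) (st (code t ++ r) b c)
      (st r ((code t).reverse ++ symM :: b) c) := by
  have h : Runs unloadLoop (1 + 5 * (code t).length) (st (code t ++ r) (symM :: b)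
      (symT :: symM :: c)) (st r ((code t).reverse ++ symM :: b) (symM :: c)) :=
    runs_unloadLoop t r (symM :: b) (symM :: c) (.loop_done rfl)
  refine (Runs.seq (.push _ _ _) (.seq (.push _ _ _) (.seq (.push _ _ _) (.seq (n := 2)
    (m := 1 + 5 * (code t).length) (S₂ := st r ((code t).reverse ++ symM :: b) (symM :: c))
    ?_ ?_)))).mono (by lia)
  · simpa using h
  · simpa using runs_pop 2 (st r ((code t).reverse ++ symM :: b) (symM :: c))

/-- Moves the top tree of stack `1` to the data stack. -/
def reload : Prog := .seq (transfer 1 0) (pop 1)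

theorem runs_reload (t : Dat) (r b c : List Cell) :
    Runs reload (3 * (code t).length + 3) (st r ((code t).reverse ++ symM :: b) c)
      (st (code t ++ r) b c) := by
  have h := runs_transfer (j := 1) (k := 0) (by decide) (code t).reverse b
    (fun a ha => isBit_of_mem_code (List.mem_reverse.mp ha)) (st r ((code t).reverse ++ symM :: b) c)
    rfl
  have h' := runs_pop 1 (st (code t ++ r) (symM :: b) c)
  simp only [update_st_one, update_st_zero, List.reverse_reverse, st_zero, st_one, List.tail_cons,
    List.length_reverse] at h h'
  exact (h.seq h').mono (by lia)

/-- Removes the top tree of the data stack. -/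
def drop : Prog := .seq unload (.seq (.loop 1 isBit (pop 1)) (pop 1))

theorem runs_clear (u a b c : List Cell) (hu : ∀ a ∈ u, isBit (some a) = true) :
    Runs (.loop 1 isBit (pop 1)) (3 * u.length + 1) (st a (u ++ symM :: b) c)
      (st a (symM :: b) c) := by
  induction u with
  | nil => exact .loop_done rfl
  | cons x u ih =>
    refine (Runs.loop_step (by simpa using hu x (by simp)) (runs_pop 1 _)
      (n := 3 * u.length + 1) ?_).mono (by simp; lia)
    simpa using ih fun b hb => hu b (List.mem_cons_of_mem _ hb)

theorem runs_drop (t : Dat) (r b c : List Cell) :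
    Runs drop (8 * (code t).length + 9) (st (code t ++ r) b c) (st r b c) := by
  have h := runs_clear (code t).reverse r b c
    fun a ha => isBit_of_mem_code (List.mem_reverse.mp ha)
  have h' := runs_pop 1 (st r (symM :: b) c)
  simp only [update_st_one, st_one, List.tail_cons, List.length_reverse] at h h'
  exact ((runs_unload t r b c).seq (h.seq h')).mono (by lia)

/-- Pushes a symbol that was read to two stacks. -/
def pushBoth : Option Cell → Prog
  | some a => .seq (.push 0 a) (.push 2 a)
  | none => .skip

theorem runs_transferBoth (u a b c : List Cell) (hu : ∀ a ∈ u, isBit (some a) = true) :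
    Runs (.loop 1 isBit (.popCase 1 pushBoth)) (4 * u.length + 1) (st a (u ++ symM :: b) c)
      (st (u.reverse ++ a) (symM :: b) (u.reverse ++ c)) := by
  induction u generalizing a c with
  | nil => exact .loop_done rfl
  | cons x u ih =>
    refine (Runs.loop_step (m := 3) (by simpa using hu x (by simp))
      (.popCase (.seq (.push _ _ _) (.push _ _ _))) (n := 4 * u.length + 1) ?_).mono (by simp; lia)
    simpa using ih (x :: a) (x :: c) fun b hb => hu b (List.mem_cons_of_mem _ hb)

/-- Duplicates the top tree of the data stack. -/
def dup : Prog :=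
  .seq unload (.seq (.push 2 symM) (.seq (.loop 1 isBit (.popCase 1 pushBoth))
    (.seq (transfer 2 1) (.seq (pop 2) reload))))

/-- Emptying the reversed code on stack `1` writes one copy to the data stack and one to stack `2`;
the latter is reversed back onto stack `1`, from where `reload` puts it on top of the first copy. -/
theorem runs_dup (t : Dat) (r b c : List Cell) :
    Runs dup (15 * (code t).length + 14) (st (code t ++ r) b c) (st (code t ++ (code t ++ r)) b c) := by
  have h₁ := runs_transferBoth (code t).reverse r b (symM :: c)
    fun a ha => isBit_of_mem_code (List.mem_reverse.mp ha)
  have h₂ := runs_transfer (j := 2) (k := 1) (by decide) (code t) c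
    (fun a ha => isBit_of_mem_code ha) (st (code t ++ r) (symM :: b) (code t ++ symM :: c)) rfl
  have h₃ := runs_pop 2 (st (code t ++ r) ((code t).reverse ++ symM :: b) (symM :: c))
  simp only [update_st_one, update_st_two, List.reverse_reverse, st_two, st_one, List.tail_cons,
    List.length_reverse] at h₁ h₂ h₃
  have h₀ := Runs.push 2 symM (st r ((code t).reverse ++ symM :: b) c)
  simp only [update_st_two, st_two] at h₀
  exact ((runs_unload t r b c).seq (h₀.seq (h₁.seq (h₂.seq (h₃.seq (runs_reload t _ b c)))))).mono
    (by lia)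

/-- Pushes the code of a tree. -/
def pushAll : List Cell → Prog
  | [] => .skip
  | a :: u => .seq (pushAll u) (.push 0 a)

theorem runs_pushAll (u r b c : List Cell) :
    Runs (pushAll u) (u.length + 1) (st r b c) (st (u ++ r) b c) := by
  induction u with
  | nil => exact .skip _
  | cons a u ih =>
    refine (ih.seq (.push 0 a _)).mono (by simp) |> cast (congrArg _ ?_)
    simp

end PolyProg

/-! ### Polynomial-time functions on encoded data and their basic closure properties -/

namespace PolyProg

open Function (update)
open StackProg

theorem eval_mono (p : Polynomial ℕ) {m n : ℕ} (h : m ≤ n) : p.eval m ≤ p.eval n := by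
  rw [Polynomial.eval_eq_sum_range, Polynomial.eval_eq_sum_range]
  gcongr

/-- Types whose elements are represented by trees. -/
class Enc (α : Type) where
  enc : α → Dat

/-- The code of an element. -/
def cd {α : Type} [Enc α] (a : α) : List Cell := code (Enc.enc a)

/-- The size of an element. -/
def size {α : Type} [Enc α] (a : α) : ℕ := (cd a).length

theorem length_code {α : Type} [Enc α] (a : α) : (code (Enc.enc a)).length = size a := rfl

variable {α β γ σ : Type} [Enc α] [Enc β] [Enc γ] [Enc σ]


instance : Enc Unit := ⟨fun _ => .nil⟩

/-- Both codes have length five and differ already in the second symbol, so a test reads two symbols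
and then discards three, whatever the value. -/
instance : Enc Bool :=
  ⟨fun b => bif b then .cons (.cons .nil .nil) .nil else .cons .nil (.cons .nil .nil)⟩

instance : Enc (α × β) := ⟨fun p => .cons (Enc.enc p.1) (Enc.enc p.2)⟩

/-- The tree of a list. -/
def encList : List α → Dat
  | [] => .nil
  | a :: l => .cons (Enc.enc a) (encList l)

instance : Enc (List α) := ⟨encList⟩

theorem cd_pair (a : α) (b : β) : cd (a, b) = symT :: (cd a ++ cd b) := rfl
theorem cd_nil : cd ([] : List α) = [symF] := rfl
theorem cd_cons (a : α) (l : List α) : cd (a :: l) = symT :: (cd a ++ cd l) := rfl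
theorem cd_true : cd true = [symT, symT, symF, symF, symF] := rfl
theorem cd_false : cd false = [symT, symF, symT, symF, symF] := rfl

@[simp] theorem size_pair (a : α) (b : β) : size (a, b) = size a + size b + 1 := by
  simp [size, cd_pair]

@[simp] theorem size_nil : size ([] : List α) = 1 := rfl

@[simp] theorem size_cons (a : α) (l : List α) : size (a :: l) = size a + size l + 1 := by
  simp [size, cd_cons]

@[simp] theorem size_bool (b : Bool) : size b = 5 := by cases b <;> rfl


theorem one_le_size (a : α) : 1 ≤ size a := by
  unfold size cd
  cases Enc.enc a <;> simp [code]

theorem length_lt_size (l : List α) : l.length < size l := by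
  induction l with
  | nil => simp
  | cons a l ih => simp; lia

theorem size_append (l l' : List α) : size (l ++ l') + 1 = size l + size l' := by
  induction l with
  | nil => simp; lia
  | cons a l ih => simp; lia

/-- Functions computable in polynomial time, by a program which replaces the argument on top of the
data stack by the value. -/
@[fun_prop]
def PT (f : α → β) : Prop :=
  ∃ (c : Prog) (p : Polynomial ℕ), ∀ a, size (f a) ≤ p.eval (size a) ∧
    ∀ r b c', Runs c (p.eval (size a)) (st (cd a ++ r) b c') (st (cd (f a) ++ r) b c')

theorem PT.of_runs {f : α → β} (c : Prog) (p q : Polynomial ℕ)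
    (hp : ∀ a, size (f a) ≤ p.eval (size a))
    (hq : ∀ a r b c', Runs c (q.eval (size a)) (st (cd a ++ r) b c') (st (cd (f a) ++ r) b c')) :
    PT f := by
  refine ⟨c, p + q, fun a => ⟨?_, fun r b c' => (hq a r b c').mono ?_⟩⟩
  · rw [Polynomial.eval_add]; exact (hp a).trans (Nat.le_add_right _ _)
  · rw [Polynomial.eval_add]; exact Nat.le_add_left _ _

theorem PT.size_le {f : α → β} (h : PT f) :
    ∃ p : Polynomial ℕ, ∀ a, size (f a) ≤ p.eval (size a) := by
  obtain ⟨c, p, h⟩ := h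
  exact ⟨p, fun a => (h a).1⟩

/-- A function that does not change the representation. -/
theorem PT.of_enc_eq {f : α → β} (h : ∀ a, Enc.enc (f a) = Enc.enc a) : PT f := by
  have h' : ∀ a, cd (f a) = cd a := fun a => congrArg code (h a)
  refine .of_runs .skip .X 1 (fun a => ?_) fun a r b c' => ?_
  · simp [size, h']
  · rw [h', Polynomial.eval_one]; exact .skip _

@[fun_prop]
theorem PT.id' : PT (fun a : α => a) := .of_enc_eq fun _ => rfl

-- The second running time is bounded in terms of the original input because `PT` also bounds the
-- size of the intermediate value.
@[fun_prop]
theorem PT.comp {g : β → γ} {f : α → β} (hg : PT g) (hf : PT f) : PT fun a => g (f a) := by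
  obtain ⟨c, p, hf⟩ := hf
  obtain ⟨d, q, hg⟩ := hg
  refine .of_runs (.seq c d) (q.comp p) (p + q.comp p) (fun a => ?_) fun a r b c' => ?_
  · rw [Polynomial.eval_comp]
    exact (hg _).1.trans (eval_mono q (hf a).1)
  · rw [Polynomial.eval_add, Polynomial.eval_comp]
    exact ((hf a).2 r b c').seq (((hg _).2 r b c').mono (eval_mono q (hf a).1))

@[fun_prop]
theorem PT.const (b : β) : PT fun _ : α => b := by
  refine .of_runs (.seq drop (pushAll (cd b))) (Polynomial.C (size b))
    (8 * .X + Polynomial.C (size b + 10)) (fun a => by simp) fun a r b' c' => ?_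
  refine ((runs_drop _ _ _ _).seq (runs_pushAll _ _ _ _)).mono ?_
  simp [size, cd]; lia

/-- Removes the top symbol of the data stack. -/
theorem runs_pop_st (a : Cell) (r b c : List Cell) :
    Runs (pop 0) 2 (st (a :: r) b c) (st r b c) := by
  simpa using runs_pop 0 (st (a :: r) b c)

theorem runs_push_st (a : Cell) (r b c : List Cell) :
    Runs (.push 0 a) 1 (st r b c) (st (a :: r) b c) := by
  simpa using Runs.push 0 a (st r b c)

theorem PT.snd : PT fun p : α × β => p.2 := by
  refine .of_runs (.seq (pop 0) drop) .X (8 * .X + 11) (fun a => ?_) fun a r b' c' => ?_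
  · obtain ⟨a, b⟩ := a
    simp; lia
  · obtain ⟨a, b⟩ := a
    rw [cd_pair, List.cons_append, List.append_assoc]
    refine ((runs_pop_st _ _ _ _).seq (runs_drop _ _ _ _)).mono ?_
    simp [length_code]; lia

theorem PT.fst : PT fun p : α × β => p.1 := by
  refine .of_runs (.seq (pop 0) (.seq unload (.seq drop reload))) .X (8 * .X + 20) (fun a => ?_)
    fun a r b' c' => ?_
  · obtain ⟨a, b⟩ := a
    simp; lia
  · obtain ⟨a, b⟩ := a
    rw [cd_pair, List.cons_append, List.append_assoc]
    refine ((runs_pop_st _ _ _ _).seq ((runs_unload _ _ _ _).seq ((runs_drop _ _ _ _).seq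
      (runs_reload _ _ _ _)))).mono ?_
    simp [length_code]; lia

@[fun_prop]
theorem PT.fst' {f : γ → α × β} (hf : PT f) : PT fun x => (f x).1 := PT.fst.comp hf

@[fun_prop]
theorem PT.snd' {f : γ → α × β} (hf : PT f) : PT fun x => (f x).2 := PT.snd.comp hf

-- The argument is duplicated, the first function is run on the upper copy, and its value is parked
-- on stack `1` while the second function runs on the lower copy. This works because programs for
-- `PT` preserve arbitrary contents below their argument and on the auxiliary stacks.
@[fun_prop]
theorem PT.prodMk {f : γ → α} {g : γ → β} (hf : PT f) (hg : PT g) : PT fun x => (f x, g x) := by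
  obtain ⟨c, p, hf⟩ := hf
  obtain ⟨d, q, hg⟩ := hg
  refine .of_runs (.seq dup (.seq c (.seq unload (.seq d (.seq reload (.push 0 symT))))))
    (p + q + 1) (15 * .X + 9 * p + q + 24) (fun a => ?_) fun a r b' c' => ?_
  · have := (hf a).1
    have := (hg a).1
    simp; lia
  · have h := (hf a).1
    rw [cd_pair, List.cons_append, List.append_assoc]
    refine ((runs_dup _ _ _ _).seq (((hf a).2 _ _ _).seq ((runs_unload _ _ _ _).seq
      (((hg a).2 _ _ _).seq ((runs_reload _ _ _ _).seq (runs_push_st _ _ _ _)))))).mono ?_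
    simp [size, cd] at *; lia

theorem PT.boolCases {f g : γ → β} (hf : PT f) (hg : PT g) :
    PT fun p : Bool × γ => bif p.1 then f p.2 else g p.2 := by
  obtain ⟨c, p, hf⟩ := hf
  obtain ⟨d, q, hg⟩ := hg
  -- The two pops remove the pair symbol and the root of the boolean; the symbol read next decides,
  -- and the three pops in each branch clear the rest of its code.
  refine .of_runs (.seq (pop 0) (.seq (pop 0) (.popCase 0 fun o => bif isT o then
    .seq (pop 0) (.seq (pop 0) (.seq (pop 0) c)) else .seq (pop 0) (.seq (pop 0) (.seq (pop 0) d)))))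
    (p + q) (p + q + 11) (fun a => ?_) fun a r b' c' => ?_
  · obtain ⟨x, a⟩ := a
    have h₁ := (hf a).1.trans (eval_mono p (show size a ≤ size (x, a) by simp; lia))
    have h₂ := (hg a).1.trans (eval_mono q (show size a ≤ size (x, a) by simp; lia))
    cases x <;> simp only [Polynomial.eval_add, cond_true, cond_false] <;> lia
  · obtain ⟨x, a⟩ := a
    have h₁ := eval_mono p (show size a ≤ size (x, a) by simp; lia)
    have h₂ := eval_mono q (show size a ≤ size (x, a) by simp; lia)
    rw [cd_pair]
    cases x
    · rw [cd_false]
      refine ((runs_pop_st _ _ _ _).seq ((runs_pop_st _ _ _ _).seq (.popCase (n := q.eval (size a) + 6)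
        ?_))).mono ?_
      · simp only [st_zero, isT, cond_false, update_st_zero]
        exact ((runs_pop_st _ _ _ _).seq ((runs_pop_st _ _ _ _).seq ((runs_pop_st _ _ _ _).seq
          ((hg a).2 _ _ _)))).mono (by lia)
      · simp only [Polynomial.eval_add, Polynomial.eval_ofNat]; lia
    · rw [cd_true]
      refine ((runs_pop_st _ _ _ _).seq ((runs_pop_st _ _ _ _).seq (.popCase (n := p.eval (size a) + 6)
        ?_))).mono ?_
      · simp only [st_zero, isT, cond_true, update_st_zero]
        exact ((runs_pop_st _ _ _ _).seq ((runs_pop_st _ _ _ _).seq ((runs_pop_st _ _ _ _).seq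
          ((hf a).2 _ _ _)))).mono (by lia)
      · simp only [Polynomial.eval_add, Polynomial.eval_ofNat]; lia

@[fun_prop]
theorem PT.cond {b : γ → Bool} {f g : γ → β} (hb : PT b) (hf : PT f) (hg : PT g) :
    PT fun x => bif b x then f x else g x :=
  (PT.boolCases hf hg).comp (hb.prodMk .id')

/-- Case distinction on a list. -/
def listCases (l : List α) (c : γ) (f : γ → β) (g : α × List α × γ → β) : β :=
  match l with
  | [] => f c
  | a :: l => g (a, l, c)

theorem PT.listCases {f : γ → β} {g : α × List α × γ → β} (hf : PT f) (hg : PT g) :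
    PT fun p : List α × γ => listCases p.1 p.2 f g := by
  obtain ⟨c, p, hf⟩ := hf
  obtain ⟨d, q, hg⟩ := hg
  -- The root symbol of the list tells whether it is empty. If not, the head is set aside on stack
  -- `1` while a pair symbol for (tail, context) is inserted, and a second pair symbol then joins
  -- the head to it.
  refine .of_runs (.seq (pop 0) (.popCase 0 fun o => bif isT o then
    .seq unload (.seq (.push 0 symT) (.seq reload (.seq (.push 0 symT) d))) else c))
    (p + q) (p + q + 8 * .X + 20) (fun a => ?_) fun a r b' c' => ?_
  · obtain ⟨l, a⟩ := a
    cases l with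
    | nil =>
      have h₁ := (hf a).1.trans (eval_mono p (show size a ≤ size (([] : List α), a) by simp; lia))
      simp only [Polynomial.eval_add, PolyProg.listCases]; lia
    | cons x l =>
      have h₁ := (hg (x, l, a)).1.trans
        (eval_mono q (show size (x, l, a) ≤ size (x :: l, a) by simp; lia))
      simp only [Polynomial.eval_add, PolyProg.listCases]; lia
  · obtain ⟨l, a⟩ := a
    rw [cd_pair]
    cases l with
    | nil =>
      have h₁ := eval_mono p (show size a ≤ size (([] : List α), a) by simp; lia)
      rw [cd_nil]
      refine ((runs_pop_st _ _ _ _).seq (.popCase (n := p.eval (size a)) ?_)).mono ?_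
      · simp only [List.append_eq, List.cons_append, st_zero, isT, update_st_zero, List.nil_append]
        exact (hf a).2 _ _ _
      · simp only [Polynomial.eval_add, Polynomial.eval_ofNat]; lia
    | cons x l =>
      have h₁ : size (x, l, a) = size (x :: l, a) := by simp; lia
      simp only [cd_cons, List.cons_append, List.append_assoc]
      refine ((runs_pop_st _ _ _ _).seq (.popCase (n := q.eval (size (x, l, a)) + 8 * size x + 11)
        ?_)).mono ?_
      · simp only [st_zero, isT, List.head?_cons, cond_true, List.tail_cons, update_st_zero]
        have := (hg (x, l, a)).2 r b' c'
        simp only [cd_pair, List.cons_append, List.append_assoc] at this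
        refine ((runs_unload _ _ _ _).seq ((runs_push_st _ _ _ _).seq ((runs_reload _ _ _ _).seq
          ((runs_push_st _ _ _ _).seq this)))).mono ?_
        simp only [size, cd]; lia
      · rw [← h₁]
        simp; lia

/-- One step of a fold. -/
def foldStep (f : γ → σ → α → σ) (p : List α × σ × γ) : List α × σ × γ :=
  listCases p.1 p.2 (fun q => ([], q)) fun q => (q.2.1, f q.2.2.2 q.2.2.1 q.1, q.2.2.2)

/-- The loop invariant omits the pair symbol in front of (list, state, context), so that the top of
the stack is the root of the list and can serve as the loop test; each round restores the symbol
before the step and removes it afterwards. `N` bounds all intermediate states at once, so every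
round costs the same. -/
theorem runs_foldLoop {f : γ → σ → α → σ} {d : Prog} {q : Polynomial ℕ}
    (hd : ∀ a, size (foldStep f a) ≤ q.eval (size a) ∧
      ∀ r b c', Runs d (q.eval (size a)) (st (cd a ++ r) b c') (st (cd (foldStep f a) ++ r) b c'))
    (N : ℕ) (c : γ) (l : List α) (s : σ)
    (hN : ∀ l₁ l₂, l = l₁ ++ l₂ → size (l₂, l₁.foldl (f c) s, c) ≤ N) (r b c' : List Cell) :
    Runs (.loop 0 isT (.seq (.push 0 symT) (.seq d (pop 0)))) ((q.eval N + 4) * l.length + 1)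
      (st (cd l ++ (cd (s, c) ++ r)) b c')
      (st (cd ([] : List α) ++ (cd (l.foldl (f c) s, c) ++ r)) b c') := by
  induction l generalizing s with
  | nil => exact .loop_done rfl
  | cons x l ih =>
    have h₁ := ih (f c s x) fun l₁ l₂ h => hN (x :: l₁) l₂ (by rw [h]; rfl)
    have h₂ := eval_mono q (hN [] (x :: l) rfl)
    have h₃ := (hd (x :: l, s, c)).2 r b c'
    have h₄ : foldStep f (x :: l, s, c) = (l, f c s x, c) := rfl
    rw [h₄, cd_pair, cd_pair l, List.cons_append, List.append_assoc, List.cons_append,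
      List.append_assoc] at h₃
    rw [List.foldl_nil] at h₂
    refine (Runs.loop_step rfl ((runs_push_st _ _ _ _).seq (h₃.seq (runs_pop_st _ _ _ _))) h₁).mono ?_
    rw [List.length_cons, Nat.mul_succ]
    lia

/-- The bound is required for every list because, applied to prefixes, it controls all intermediate
states and not just the final one. -/
theorem PT.foldl_of_bound {f : γ → σ → α → σ} (hf : PT fun p : γ × σ × α => f p.1 p.2.1 p.2.2)
    (hb : ∃ q : Polynomial ℕ, ∀ c s (l : List α),
      size (l.foldl (f c) s) ≤ q.eval (size c + size s + size l)) :
    PT fun p : γ × σ × List α => p.2.2.foldl (f p.1) p.2.1 := by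
  obtain ⟨q, hq⟩ := hb
  have hstep : PT (foldStep f) := by
    refine PT.listCases (f := fun q => (([] : List α), q))
      (g := fun q => (q.2.1, f q.2.2.2 q.2.2.1 q.1, q.2.2.2)) (by fun_prop) ?_
    have := hf.comp (f := fun q : α × List α × σ × γ => (q.2.2.2, q.2.2.1, q.1)) (by fun_prop)
    fun_prop
  obtain ⟨d, p, hd⟩ := hstep
  have hloop : PT fun p : List α × σ × γ => (([] : List α), p.1.foldl (f p.2.2) p.2.1, p.2.2) := by
    refine .of_runs (.seq (pop 0) (.seq (.loop 0 isT (.seq (.push 0 symT) (.seq d (pop 0))))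
      (.seq (.push 0 symT) .skip))) (q + .X + 5)
      ((p.comp (.X + q + 2) + 4) * .X + 5) (fun a => ?_) fun a r b c' => ?_
    · obtain ⟨l, s, c⟩ := a
      have h₁ := (hq c s l).trans
        (eval_mono q (show size c + size s + size l ≤ size (l, s, c) by simp; lia))
      simp at *; lia
    · obtain ⟨l, s, c⟩ := a
      have h := runs_foldLoop hd ((Polynomial.X + q + 2).eval (size (l, s, c))) c l s
        (fun l₁ l₂ h => ?_) r b c'
      · rw [cd_pair l, cd_pair [], List.cons_append, List.append_assoc, List.cons_append,
          List.append_assoc]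
        refine ((runs_pop_st _ _ _ _).seq (h.seq ((runs_push_st _ _ _ _).seq (.skip _)))).mono ?_
        have := length_lt_size l
        have : l.length ≤ size (l, s, c) := by simp; lia
        have e : ((p.comp (.X + q + 2) + 4) * .X + 5).eval (size (l, s, c)) =
            (p.eval ((Polynomial.X + q + 2).eval (size (l, s, c))) + 4) * size (l, s, c) + 5 := by
          simp only [Polynomial.eval_add, Polynomial.eval_mul, Polynomial.eval_comp,
            Polynomial.eval_X, Polynomial.eval_ofNat]
        rw [e]
        have := Nat.mul_le_mul_left
          (p.eval ((Polynomial.X + q + 2).eval (size (l, s, c))) + 4) this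
        lia
      · have h₁ : size l₁ + size l₂ = size l + 1 := by rw [h, size_append]
        have h₂ := (hq c s l₁).trans (eval_mono q
          (show size c + size s + size l₁ ≤ size (l, s, c) by
            have := one_le_size l₂
            simp; lia))
        have := one_le_size l₁
        simp at *; lia
  have := hloop.comp (f := fun p : γ × σ × List α => (p.2.2, p.2.1, p.1)) (by fun_prop)
  exact this.snd'.fst'

/-- A fold is computable in polynomial time if a measure of the state grows slowly. -/
theorem PT.foldl {f : γ → σ → α → σ} {s : γ → σ} {l : γ → List α}
    (hf : PT fun p : γ × σ × α => f p.1 p.2.1 p.2.2) (hs : PT s) (hl : PT l) (m : σ → ℕ)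
    (h₁ : ∃ p : Polynomial ℕ, ∀ s, m s ≤ p.eval (size s))
    (h₂ : ∃ p : Polynomial ℕ, ∀ s, size s ≤ p.eval (m s))
    (h₃ : ∃ p : Polynomial ℕ, ∀ c s x, m (f c s x) ≤ m s + p.eval (size c + size x)) :
    PT fun c => (l c).foldl (f c) (s c) := by
  obtain ⟨p₁, h₁⟩ := h₁
  obtain ⟨p₂, h₂⟩ := h₂
  obtain ⟨p₃, h₃⟩ := h₃
  -- The increment of the measure does not depend on the state, so the increments add up over the
  -- list; a growth factor per step would lead to exponential size.
  have key : ∀ c (l : List α) s, m (l.foldl (f c) s) ≤ m s + l.length * p₃.eval (size c + size l) := by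
    intro c l
    induction l with
    | nil => simp
    | cons x l ih =>
      intro s
      have h := ih (f c s x)
      have h' := h₃ c s x
      have e₁ := eval_mono p₃ (show size c + size x ≤ size c + size (x :: l) by simp; lia)
      have e₂ := Nat.mul_le_mul_left l.length
        (eval_mono p₃ (show size c + size l ≤ size c + size (x :: l) by simp; lia))
      rw [List.foldl_cons, List.length_cons, Nat.succ_mul]
      lia
  have := PT.foldl_of_bound hf ⟨p₂.comp (p₁ + .X * p₃), fun c s l => (h₂ _).trans ?_⟩
  · exact this.comp (f := fun c => (c, s c, l c)) (by fun_prop)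
  · rw [Polynomial.eval_comp]
    refine eval_mono p₂ ((key c l s).trans ?_)
    have := length_lt_size l
    rw [Polynomial.eval_add, Polynomial.eval_mul, Polynomial.eval_X]
    gcongr
    · exact (h₁ s).trans (eval_mono p₁ (by lia))
    · lia
    · exact eval_mono p₃ (by lia)

end PolyProg

/-! ### A library of polynomial-time operations, up to the verifier -/

namespace PolyProg

variable {α β γ σ δ : Type} [Enc α] [Enc β] [Enc γ] [Enc σ] [Enc δ]

/-- Programs see only codes, so a change of type that keeps the code is free. In this way numbers
are treated as their digit lists and symbols as triples of booleans. -/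
theorem PT.congr_enc {f : α → β} {g : α → γ} (hg : PT g)
    (h : ∀ a, Enc.enc (f a) = Enc.enc (g a)) : PT f := by
  have h' : ∀ a, cd (f a) = cd (g a) := fun a => congrArg code (h a)
  obtain ⟨c, p, hg⟩ := hg
  refine ⟨c, p, fun a => ?_⟩
  have := hg a
  simpa only [size, h'] using this

theorem PT.congr_fun {f g : α → β} (hg : PT g) (h : ∀ a, f a = g a) : PT f :=
  hg.congr_enc fun a => by rw [h]

theorem PT.size_le_add {f : γ → α → β} (h : PT fun p : γ × α => f p.1 p.2) :
    ∃ p : Polynomial ℕ, ∀ c a, size (f c a) ≤ p.eval (size c + size a) := by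
  obtain ⟨p, hp⟩ := h.size_le
  refine ⟨p.comp (.X + 1), fun c a => (hp (c, a)).trans ?_⟩
  simp

/-- A fold is computable in polynomial time if the size of the state grows slowly. -/
theorem PT.foldl_size {f : γ → σ → α → σ} {s : γ → σ} {l : γ → List α}
    (hf : PT fun p : γ × σ × α => f p.1 p.2.1 p.2.2) (hs : PT s) (hl : PT l)
    (h : ∃ p : Polynomial ℕ, ∀ c s x, size (f c s x) ≤ size s + p.eval (size c + size x)) :
    PT fun c => (l c).foldl (f c) (s c) :=
  .foldl hf hs hl size ⟨.X, by simp⟩ ⟨.X, by simp⟩ h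

/-! ### Booleans -/

@[fun_prop]
theorem PT.and {f g : γ → Bool} (hf : PT f) (hg : PT g) : PT fun x => f x && g x :=
  (hf.cond hg (.const false)).congr_fun fun x => by cases f x <;> rfl

@[fun_prop]
theorem PT.or {f g : γ → Bool} (hf : PT f) (hg : PT g) : PT fun x => f x || g x :=
  (hf.cond (.const true) hg).congr_fun fun x => by cases f x <;> rfl

@[fun_prop]
theorem PT.not {f : γ → Bool} (hf : PT f) : PT fun x => !f x :=
  (hf.cond (.const false) (.const true)).congr_fun fun x => by cases f x <;> rfl

@[fun_prop]
theorem PT.xor {f g : γ → Bool} (hf : PT f) (hg : PT g) : PT fun x => f x ^^ g x :=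
  (hf.cond hg.not hg).congr_fun fun x => by cases f x <;> simp

/-! ### Lists -/

@[fun_prop]
theorem PT.list_cons {f : γ → α} {l : γ → List α} (hf : PT f) (hl : PT l) :
    PT fun x => f x :: l x :=
  (hf.prodMk hl).congr_enc fun _ => rfl

@[fun_prop]
theorem PT.headD {l : γ → List α} {d : γ → α} (hl : PT l) (hd : PT d) :
    PT fun x => (l x).headD (d x) :=
  ((PT.listCases (f := fun d : α => d) (g := fun q => q.1) (by fun_prop) (by fun_prop)).comp
    (hl.prodMk hd)).congr_fun fun x => by cases l x <;> simp [PolyProg.listCases]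

@[fun_prop]
theorem PT.tail {l : γ → List α} (hl : PT l) : PT fun x => (l x).tail :=
  ((PT.listCases (f := fun _ : Unit => ([] : List α)) (g := fun q => q.2.1) (by fun_prop)
    (by fun_prop)).comp (hl.prodMk (.const ()))).congr_fun fun x => by
      cases l x <;> simp [PolyProg.listCases]

@[fun_prop]
theorem PT.isEmpty {l : γ → List α} (hl : PT l) : PT fun x => (l x).isEmpty :=
  ((PT.listCases (α := α) (f := fun _ : Unit => true) (g := fun _ => false) (by fun_prop)
    (by fun_prop)).comp (hl.prodMk (.const ()))).congr_fun fun x => by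
      cases l x <;> simp [PolyProg.listCases]

theorem size_tail_le (l : List α) : size l.tail ≤ size l := by
  cases l with
  | nil => simp
  | cons a l => simp; lia

theorem size_cond_le (b : Bool) (x y : α) : size (bif b then x else y) ≤ max (size x) (size y) := by
  cases b <;> simp

@[fun_prop]
theorem PT.reverse {l : γ → List α} (hl : PT l) : PT fun x => (l x).reverse := by
  have : PT fun l : List α => l.foldl (fun acc x => x :: acc) [] :=
    PT.foldl_size (f := fun _ acc x => x :: acc) (by fun_prop) (.const _) .id'
      ⟨.X + 1, fun c s x => by simp; lia⟩
  exact (this.comp hl).congr_fun fun x => by simp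

@[fun_prop]
theorem PT.append {l l' : γ → List α} (hl : PT l) (hl' : PT l') : PT fun x => l x ++ l' x := by
  have : PT fun p : List α × List α => p.1.reverse.foldl (fun acc x => x :: acc) p.2 :=
    PT.foldl_size (f := fun _ acc x => x :: acc) (by fun_prop) (by fun_prop) (by fun_prop)
      ⟨.X + 1, fun c s x => by simp; lia⟩
  exact (this.comp (hl.prodMk hl')).congr_fun fun x => by simp

theorem PT.foldr {f : γ → α → σ → σ} {s : γ → σ} {l : γ → List α}
    (hf : PT fun p : γ × σ × α => f p.1 p.2.2 p.2.1) (hs : PT s) (hl : PT l) (m : σ → ℕ)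
    (h₁ : ∃ p : Polynomial ℕ, ∀ s, m s ≤ p.eval (size s))
    (h₂ : ∃ p : Polynomial ℕ, ∀ s, size s ≤ p.eval (m s))
    (h₃ : ∃ p : Polynomial ℕ, ∀ c s x, m (f c x s) ≤ m s + p.eval (size c + size x)) :
    PT fun c => (l c).foldr (f c) (s c) :=
  (PT.foldl (f := fun c s x => f c x s) hf hs hl.reverse m h₁ h₂ h₃).congr_fun fun c => by simp

theorem PT.foldr_size {f : γ → α → σ → σ} {s : γ → σ} {l : γ → List α}
    (hf : PT fun p : γ × σ × α => f p.1 p.2.2 p.2.1) (hs : PT s) (hl : PT l)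
    (h : ∃ p : Polynomial ℕ, ∀ c s x, size (f c x s) ≤ size s + p.eval (size c + size x)) :
    PT fun c => (l c).foldr (f c) (s c) :=
  .foldr hf hs hl size ⟨.X, by simp⟩ ⟨.X, by simp⟩ h

theorem PT.map {f : γ → α → β} {l : γ → List α} (hf : PT fun p : γ × α => f p.1 p.2)
    (hl : PT l) : PT fun c => (l c).map (f c) := by
  obtain ⟨p, hp⟩ := hf.size_le_add
  have hf' := hf.comp (f := fun p : γ × List β × α => (p.1, p.2.2)) (by fun_prop)
  have : PT fun c => (l c).foldr (fun x acc => f c x :: acc) [] :=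
    PT.foldr_size (f := fun c x acc => f c x :: acc) (by fun_prop) (.const _) hl
      ⟨p + 1, fun c s x => by have := hp c x; simp; lia⟩
  exact this.congr_fun fun c => by induction l c with
    | nil => rfl
    | cons a l ih => rw [List.map_cons, ih]; rfl

theorem PT.flatMap {f : γ → α → List β} {l : γ → List α} (hf : PT fun p : γ × α => f p.1 p.2)
    (hl : PT l) : PT fun c => (l c).flatMap (f c) := by
  obtain ⟨p, hp⟩ := hf.size_le_add
  have hf' := hf.comp (f := fun p : γ × List β × α => (p.1, p.2.2)) (by fun_prop)
  have : PT fun c => (l c).foldr (fun x acc => f c x ++ acc) [] :=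
    PT.foldr_size (f := fun c x acc => f c x ++ acc) (by fun_prop) (.const _) hl
      ⟨p, fun c s x => by have := hp c x; have := size_append (f c x) s; lia⟩
  exact this.congr_fun fun c => by induction l c with
    | nil => rfl
    | cons a l ih => rw [List.flatMap_cons, ih]; rfl

theorem PT.all {f : γ → α → Bool} {l : γ → List α} (hf : PT fun p : γ × α => f p.1 p.2)
    (hl : PT l) : PT fun c => (l c).all (f c) := by
  have hf' := hf.comp (f := fun p : γ × Bool × α => (p.1, p.2.2)) (by fun_prop)
  have : PT fun c => (l c).foldr (fun x acc => f c x && acc) true :=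
    PT.foldr_size (f := fun c x acc => f c x && acc) (by fun_prop) (.const _) hl
      ⟨0, fun c s x => by simp⟩
  exact this.congr_fun fun c => by induction l c with
    | nil => rfl
    | cons a l ih => rw [List.all_cons, ih]; rfl

theorem PT.any {f : γ → α → Bool} {l : γ → List α} (hf : PT fun p : γ × α => f p.1 p.2)
    (hl : PT l) : PT fun c => (l c).any (f c) :=
  (PT.all (f := fun c x => !f c x) hf.not hl).not.congr_fun fun c => by
    rw [List.not_all_eq_any_not]; simp

/-- The fold runs over the first list and keeps the unread part of the second list in its state;
once that part is exhausted, the remaining rounds change nothing. -/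
theorem foldl_zip_aux {α β : Type} (l : List α) (l' : List β) (out : List (α × β)) :
    (l.foldl (fun (s : List β × List (α × β)) x =>
      listCases s.1 (s.2, x) (fun q => ([], q.1)) fun q => (q.2.1, (q.2.2.2, q.1) :: q.2.2.1))
      (l', out)).2 = (l.zip l').reverse ++ out := by
  induction l generalizing l' out with
  | nil => simp
  | cons a l ih =>
    rw [List.foldl_cons]
    cases l' with
    | nil => simpa [listCases] using ih [] out
    | cons b l' => exact (ih l' ((a, b) :: out)).trans (by simp)

@[fun_prop]
theorem PT.zip {l : γ → List α} {l' : γ → List β} (hl : PT l) (hl' : PT l') :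
    PT fun x => (l x).zip (l' x) := by
  have : PT fun p : List α × List β => p.1.foldl (fun (s : List β × List (α × β)) x =>
      PolyProg.listCases s.1 (s.2, x) (fun q => ([], q.1))
        fun q => (q.2.1, (q.2.2.2, q.1) :: q.2.2.1)) (p.2, []) := by
    refine PT.foldl_size (f := fun _ (s : List β × List (α × β)) x =>
      PolyProg.listCases s.1 (s.2, x) (fun q => ([], q.1))
        fun q => (q.2.1, (q.2.2.2, q.1) :: q.2.2.1)) ?_ (by fun_prop) (by fun_prop)
      ⟨.X + 1, fun c s x => ?_⟩
    · exact (PT.listCases (α := β) (γ := List (α × β) × α) (f := fun q => (([] : List β), q.1))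
        (g := fun q => (q.2.1, (q.2.2.2, q.1) :: q.2.2.1)) (by fun_prop) (by fun_prop)).comp
        (f := fun p : (List α × List β) × (List β × List (α × β)) × α =>
          (p.2.1.1, (p.2.1.2, p.2.2))) (by fun_prop)
    · obtain ⟨l, out⟩ := s
      cases l with
      | nil => simp [PolyProg.listCases]
      | cons b l => simp [PolyProg.listCases]; lia
  exact (this.snd'.reverse.comp (hl.prodMk hl')).congr_fun fun x => by
    rw [foldl_zip_aux]; simp

/-- Drops as many elements as another list has. -/
theorem PT.drop_length {l : γ → List α} {l' : γ → List β} (hl : PT l) (hl' : PT l') :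
    PT fun x => (l' x).drop (l x).length := by
  have : PT fun p : List α × List β => p.1.foldl (fun s _ => s.tail) p.2 :=
    PT.foldl_size (f := fun _ (s : List β) _ => s.tail) (by fun_prop) (by fun_prop) (by fun_prop)
      ⟨0, fun c s x => by simpa using size_tail_le s⟩
  have key : ∀ (l : List α) (l' : List β), l'.drop l.length = l.foldl (fun s _ => s.tail) l' := by
    intro l
    induction l with
    | nil => simp
    | cons a l ih => intro l'; simp [← ih]
  exact (this.comp (hl.prodMk hl')).congr_fun fun x => key _ _

/-! ### Symbols -/

/-- A binary code for symbols. -/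
def cellBits : Cell → Bool × Bool × Bool
  | none => (false, false, false)
  | some (.bit b) => (true, false, b)
  | some .minus => (false, true, false)
  | some .slash => (false, true, true)
  | some .sep => (true, true, true)

/-- The symbol with a given code. -/
def ofCellBits : Bool × Bool × Bool → Cell
  | (true, false, b) => some (.bit b)
  | (false, true, false) => some .minus
  | (false, true, true) => some .slash
  | (true, true, _) => some .sep
  | (false, false, _) => none

theorem ofCellBits_cellBits (g : Cell) : ofCellBits (cellBits g) = g := by
  rcases g with _ | _ | _ | _ | _ <;> rfl

instance : Enc Cell := ⟨fun g => Enc.enc (cellBits g)⟩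

@[simp] theorem size_cell (g : Cell) : size g = 17 := by
  have : size g = size (cellBits g) := rfl
  rw [this]
  obtain ⟨a, b, c⟩ := cellBits g
  simp

/-- There are finitely many symbols, so a nested test of the three code bits reduces the claim to
one function for each fixed symbol. -/
theorem PT.cellCases {f : Cell → γ → β} {g : γ → Cell} (hf : ∀ a, PT (f a)) (hg : PT g) :
    PT fun x => f (g x) x := by
  have hb : PT fun x => cellBits (g x) := hg.congr_enc fun _ => rfl
  have : PT fun x => bif (cellBits (g x)).1 then
      (bif (cellBits (g x)).2.1 then f (some .sep) x else
        bif (cellBits (g x)).2.2 then f (some (.bit true)) x else f (some (.bit false)) x)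
    else (bif (cellBits (g x)).2.1 then
        (bif (cellBits (g x)).2.2 then f (some .slash) x else f (some .minus) x)
        else f none x) := by fun_prop
  exact this.congr_fun fun x => by
    rcases g x with _ | (_ | _) | _ | _ | _ <;> rfl

end PolyProg

namespace PolyProg

variable {α β γ σ δ : Type} [Enc α] [Enc β] [Enc γ] [Enc σ] [Enc δ]

/-! ### Natural numbers in binary -/

instance : Enc ℕ := ⟨fun n => Enc.enc n.bits⟩

theorem size_boolList (l : List Bool) : size l = 6 * l.length + 1 := by
  induction l with
  | nil => rfl
  | cons b l ih => simp [ih]; lia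

theorem size_nat (n : ℕ) : size n = 6 * n.size + 1 := by
  have : size n = size n.bits := rfl
  rw [this, size_boolList, Nat.size_eq_bits_len]

/-- The number with the given binary digits, the least significant one first. -/
def ofBits (l : List Bool) : ℕ := l.foldr Nat.bit 0

theorem ofBits_bits (n : ℕ) : ofBits n.bits = n := by
  induction n using Nat.binaryRec' with
  | zero => rfl
  | bit b n h ih => rw [Nat.bits_append_bit _ _ h, ofBits, List.foldr_cons]; exact congrArg _ ih

@[fun_prop]
theorem PT.bits {f : γ → ℕ} (hf : PT f) : PT fun x => (f x).bits := hf.congr_enc fun _ => rfl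

/-- Prepending a digit is correct except for the digit 0 in front of the number 0, which would
create a leading zero. -/
theorem bits_bit (b : Bool) (n : ℕ) :
    (Nat.bit b n).bits = bif n.bits.isEmpty && !b then [] else b :: n.bits := by
  by_cases h : n = 0 → b = true
  · rw [Nat.bits_append_bit _ _ h]
    cases b
    · have hn : n ≠ 0 := by simpa using h
      have : n.bits ≠ [] := fun e => hn (by rw [← ofBits_bits n, e]; rfl)
      cases hb : n.bits with
      | nil => exact absurd hb this
      | cons => simp
    · simp
  · push Not at h
    obtain ⟨rfl, hb⟩ := h
    simp only [ne_eq, Bool.not_eq_true] at hb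
    subst hb
    simp

@[fun_prop]
theorem PT.bit {b : γ → Bool} {f : γ → ℕ} (hb : PT b) (hf : PT f) :
    PT fun x => Nat.bit (b x) (f x) := by
  have : PT fun x => bif (f x).bits.isEmpty && !b x then [] else b x :: (f x).bits := by fun_prop
  exact this.congr_enc fun x => congrArg Enc.enc (bits_bit (b x) (f x))

theorem size_bit_le (b : Bool) (n : ℕ) : size (Nat.bit b n) ≤ size n + 6 := by
  have h : size (Nat.bit b n) = size (Nat.bit b n).bits := rfl
  have h' : size n = size n.bits := rfl
  rw [h, h', bits_bit]
  refine (size_cond_le _ _ _).trans ?_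
  simp; lia

@[fun_prop]
theorem PT.ofBits {l : γ → List Bool} (hl : PT l) : PT fun x => ofBits (l x) :=
  PT.foldr_size (f := fun _ b n => Nat.bit b n) (by fun_prop) (.const _) hl
    ⟨6, fun c s x => by simpa using size_bit_le x s⟩

@[fun_prop]
theorem PT.div2 {f : γ → ℕ} (hf : PT f) : PT fun x => (f x).div2 :=
  hf.bits.tail.congr_enc fun x => congrArg Enc.enc (Nat.div2_bits_eq_tail (f x))

@[fun_prop]
theorem PT.bodd {f : γ → ℕ} (hf : PT f) : PT fun x => (f x).bodd :=
  (hf.bits.headD (.const false)).congr_fun fun x => by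
    rw [Nat.bodd_eq_bits_head]; cases (f x).bits <;> rfl

theorem size_div2_le (n : ℕ) : size n.div2 ≤ size n := by
  have h : size n.div2 = size n.bits.tail := by rw [← Nat.div2_bits_eq_tail]; rfl
  rw [h]
  exact size_tail_le _

/-- The majority of three booleans. -/
def maj (a b c : Bool) : Bool := (a && b) || (a && c) || (b && c)

/-- One step of the addition of binary numbers. -/
def addStep (s : (ℕ × ℕ) × Bool × List Bool) : (ℕ × ℕ) × Bool × List Bool :=
  ((s.1.1.div2, s.1.2.div2), maj s.1.1.bodd s.1.2.bodd s.2.1,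
    ((s.1.1.bodd ^^ s.1.2.bodd) ^^ s.2.1) :: s.2.2)

theorem foldl_bit (l : List Bool) (n : ℕ) :
    l.foldl (fun n b => Nat.bit b n) n = l.foldl (fun n b => Nat.bit b n) 0 + 2 ^ l.length * n := by
  induction l generalizing n with
  | nil => simp
  | cons b l ih =>
    rw [List.foldl_cons, List.foldl_cons, ih, ih (Nat.bit b 0), List.length_cons, Nat.bit_val,
      Nat.bit_val]
    ring

/-- The invariant of schoolbook addition: the digits already written, plus 2^k times the unread
parts and the carry, equal the sum. The newest digit stands at the head, so `out` is read with
`foldl`, most significant digit first. -/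
theorem addStep_iterate (a b k : ℕ) :
    ∃ c out, addStep^[k] ((a, b), false, []) = ((a / 2 ^ k, b / 2 ^ k), c, out) ∧
      out.length = k ∧
      out.foldl (fun n b => Nat.bit b n) 0 + 2 ^ k * (a / 2 ^ k + b / 2 ^ k + c.toNat) = a + b := by
  induction k with
  | zero => exact ⟨false, [], by simp⟩
  | succ k ih =>
    obtain ⟨c, out, h₁, h₂, h₃⟩ := ih
    rw [Function.iterate_succ_apply', h₁]
    refine ⟨_, _, by simp only [addStep, Nat.div2_val, Nat.div_div_eq_div_mul, pow_succ]; rfl,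
      by simp [h₂], ?_⟩
    rw [List.foldl_cons, foldl_bit, h₂, ← h₃, add_assoc]
    congr 1
    rw [pow_succ, mul_assoc, ← mul_add]
    congr 1
    rw [← Nat.div_div_eq_div_mul, ← Nat.div_div_eq_div_mul]
    generalize a / 2 ^ k = x
    generalize b / 2 ^ k = y
    have hx := Nat.bodd_add_div2 x
    have hy := Nat.bodd_add_div2 y
    rw [Nat.div2_val] at hx hy
    rw [Nat.bit_val]
    generalize hxb : x.bodd = xb at *
    generalize hyb : y.bodd = yb at *
    cases xb <;> cases yb <;> cases c <;> simp [maj] at * <;> lia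

theorem add_eq_foldl (a b : ℕ) :
    a + b = ((a.bits ++ b.bits ++ [true]).foldl (fun s _ => addStep s) ((a, b), false, [])).2.2.foldl
      (fun n b => Nat.bit b n) 0 := by
  have hfold : ∀ (l : List Bool) s, l.foldl (fun s _ => addStep s) s = addStep^[l.length] s := by
    intro l
    induction l with
    | nil => intro s; rfl
    | cons x l ih => intro s; rw [List.foldl_cons, ih]; rfl
  rw [hfold]
  set k := (a.bits ++ b.bits ++ [true]).length with hk
  have hk' : k = a.size + b.size + 1 := by simp [hk, ← Nat.size_eq_bits_len, add_assoc]
  obtain ⟨c, out, h₁, h₂, h₃⟩ := addStep_iterate a b k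
  -- The appended `true` provides one extra round: both summands are below 2^(k-1), so their sum is
  -- below 2^k and the final carry must be 0.
  have ha : a < 2 ^ (k - 1) := (Nat.lt_size_self a).trans_le (Nat.pow_le_pow_right (by lia) (by lia))
  have hb : b < 2 ^ (k - 1) := (Nat.lt_size_self b).trans_le (Nat.pow_le_pow_right (by lia) (by lia))
  have hp : 2 ^ k = 2 * 2 ^ (k - 1) := by rw [← pow_succ']; congr 1; lia
  rw [h₁]
  rw [Nat.div_eq_of_lt (by lia), Nat.div_eq_of_lt (by lia)] at h₃
  cases c
  · simpa using h₃.symm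
  · simp at h₃; lia

@[fun_prop]
theorem PT.addStep {f : γ → (ℕ × ℕ) × Bool × List Bool} (hf : PT f) : PT fun x => addStep (f x) := by
  unfold PolyProg.addStep maj
  fun_prop

@[fun_prop]
theorem PT.add {f g : γ → ℕ} (hf : PT f) (hg : PT g) : PT fun x => f x + g x := by
  have h₁ : PT fun p : ℕ × ℕ => (p.1.bits ++ p.2.bits ++ [true]).foldl
      (fun s _ => PolyProg.addStep s) ((p.1, p.2), false, []) := by
    refine PT.foldl_size (f := fun _ s (_ : Bool) => PolyProg.addStep s) (by fun_prop)
      (by fun_prop) (by fun_prop) ⟨6, fun c s x => ?_⟩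
    have := size_div2_le s.1.1
    have := size_div2_le s.1.2
    obtain ⟨⟨a, b⟩, c, l⟩ := s
    simp [PolyProg.addStep] at *; lia
  have h₂ : PT fun l : List Bool => l.foldl (fun n b => Nat.bit b n) 0 :=
    PT.foldl_size (f := fun _ n b => Nat.bit b n) (by fun_prop) (.const _) .id'
      ⟨6, fun c s x => by simpa using size_bit_le x s⟩
  exact (h₂.comp (h₁.snd'.snd'.comp (hf.prodMk hg))).congr_fun fun x => add_eq_foldl _ _

theorem natSize_add_le (a b : ℕ) : (a + b).size ≤ max a.size b.size + 1 := by
  rw [Nat.size_le, pow_succ]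
  have ha := (Nat.lt_size_self a).trans_le
    (Nat.pow_le_pow_right (n := 2) (by lia) (le_max_left a.size b.size))
  have hb := (Nat.lt_size_self b).trans_le
    (Nat.pow_le_pow_right (n := 2) (by lia) (le_max_right a.size b.size))
  lia

theorem natSize_mul_le (a b : ℕ) : (a * b).size ≤ a.size + b.size := by
  rw [Nat.size_le, pow_add]
  exact Nat.mul_lt_mul'' (Nat.lt_size_self a) (Nat.lt_size_self b)

/-- Horner's scheme in base 2: double, then add the second factor if the digit is 1. -/
theorem mul_eq_foldr (a b : ℕ) :
    a * b = a.bits.foldr (fun x n => n + n + bif x then b else 0) 0 := by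
  have : ∀ l : List Bool, l.foldr (fun x n => n + n + bif x then b else 0) 0 = ofBits l * b := by
    intro l
    induction l with
    | nil => simp [ofBits]
    | cons x l ih =>
      have : ofBits (x :: l) = Nat.bit x (ofBits l) := rfl
      rw [List.foldr_cons, ih, this, Nat.bit_val]
      cases x <;> simp <;> ring
  rw [this, ofBits_bits]

@[fun_prop]
theorem PT.mul {f g : γ → ℕ} (hf : PT f) (hg : PT g) : PT fun x => f x * g x := by
  have : PT fun p : ℕ × ℕ => p.1.bits.foldr (fun x n => n + n + bif x then p.2 else 0) 0 := by
    refine PT.foldr_size (f := fun (p : ℕ × ℕ) x n => n + n + bif x then p.2 else 0) (by fun_prop)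
      (.const _) (by fun_prop) ⟨.X + 12, fun c s x => ?_⟩
    have h₁ := natSize_add_le (s + s) (bif x then c.2 else 0)
    have h₂ := natSize_add_le s s
    have h₃ : (bif x then c.2 else 0).size ≤ c.2.size := by cases x <;> simp
    obtain ⟨a, b⟩ := c
    simp [size_nat] at *
    lia
  exact (this.comp (hf.prodMk hg)).congr_fun fun x => mul_eq_foldr _ _

/-- One step of the comparison of binary numbers. -/
def leStep (s : (ℕ × ℕ) × Bool) : (ℕ × ℕ) × Bool :=
  ((s.1.1.div2, s.1.2.div2), bif s.1.1.bodd ^^ s.1.2.bodd then s.1.2.bodd else s.2)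

/-- The flag is the result of comparing the k lowest digits; a later, more significant digit
overrides it exactly when the two numbers differ there. -/
theorem leStep_iterate (a b k : ℕ) :
    ∃ c, leStep^[k] ((a, b), true) = ((a / 2 ^ k, b / 2 ^ k), c) ∧
      (a ≤ b ↔ a / 2 ^ k < b / 2 ^ k ∨ a / 2 ^ k = b / 2 ^ k ∧ c = true) := by
  induction k with
  | zero => exact ⟨true, by simp [le_iff_lt_or_eq]⟩
  | succ k ih =>
    obtain ⟨c, h₁, h₂⟩ := ih
    rw [Function.iterate_succ_apply', h₁]
    refine ⟨_, by simp only [leStep, Nat.div2_val, Nat.div_div_eq_div_mul, pow_succ]; rfl, ?_⟩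
    rw [h₂, pow_succ, ← Nat.div_div_eq_div_mul, ← Nat.div_div_eq_div_mul]
    generalize a / 2 ^ k = x
    generalize b / 2 ^ k = y
    have hx := Nat.bodd_add_div2 x
    have hy := Nat.bodd_add_div2 y
    rw [Nat.div2_val] at hx hy
    generalize hxb : x.bodd = xb at *
    generalize hyb : y.bodd = yb at *
    cases xb <;> cases yb <;> cases c <;> simp at * <;> lia

theorem le_eq_foldl (a b : ℕ) :
    decide (a ≤ b) = ((a.bits ++ b.bits).foldl (fun s _ => leStep s) ((a, b), true)).2 := by
  have hfold : ∀ (l : List Bool) s, l.foldl (fun s _ => leStep s) s = leStep^[l.length] s := by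
    intro l
    induction l with
    | nil => intro s; rfl
    | cons x l ih => intro s; rw [List.foldl_cons, ih]; rfl
  rw [hfold]
  obtain ⟨c, h₁, h₂⟩ := leStep_iterate a b (a.bits ++ b.bits).length
  have hk : (a.bits ++ b.bits).length = a.size + b.size := by simp [Nat.size_eq_bits_len]
  rw [h₁]
  rw [hk, Nat.div_eq_of_lt ((Nat.lt_size_self a).trans_le (Nat.pow_le_pow_right (by lia) (by lia))),
    Nat.div_eq_of_lt ((Nat.lt_size_self b).trans_le (Nat.pow_le_pow_right (by lia) (by lia)))] at h₂
  cases c <;> simpa using h₂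

@[fun_prop]
theorem PT.natLe {f g : γ → ℕ} (hf : PT f) (hg : PT g) : PT fun x => decide (f x ≤ g x) := by
  have : PT fun p : ℕ × ℕ => ((p.1.bits ++ p.2.bits).foldl (fun s _ => leStep s)
      ((p.1, p.2), true)) := by
    refine PT.foldl_size (f := fun _ s (_ : Bool) => leStep s) ?_
      (by fun_prop) (by fun_prop) ⟨0, fun c s x => ?_⟩
    · unfold leStep
      fun_prop
    · have := size_div2_le s.1.1
      have := size_div2_le s.1.2
      obtain ⟨⟨a, b⟩, c⟩ := s
      simp [leStep] at *; lia
  exact (this.snd'.comp (hf.prodMk hg)).congr_fun fun x => le_eq_foldl _ _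

@[fun_prop]
theorem PT.natEq {f g : γ → ℕ} (hf : PT f) (hg : PT g) : PT fun x => decide (f x = g x) :=
  ((hf.natLe hg).and (hg.natLe hf)).congr_fun fun x => by
    rw [← Bool.decide_and]; exact decide_eq_decide.mpr le_antisymm_iff

end PolyProg

namespace PolyProg

variable {α β γ σ δ : Type} [Enc α] [Enc β] [Enc γ] [Enc σ] [Enc δ]

/-! ### Strings -/

/-- Equality of symbols. -/
def cellEq (a b : Cell) : Bool :=
  !((cellBits a).1 ^^ (cellBits b).1) && !((cellBits a).2.1 ^^ (cellBits b).2.1) &&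
    !((cellBits a).2.2 ^^ (cellBits b).2.2)

theorem cellEq_iff (a b : Cell) : cellEq a b = true ↔ a = b := by
  constructor
  · intro h
    rw [← ofCellBits_cellBits a, ← ofCellBits_cellBits b]
    congr 1
    revert h
    unfold cellEq
    generalize cellBits a = x
    generalize cellBits b = y
    revert x y
    decide
  · rintro rfl
    simp [cellEq]

@[fun_prop]
theorem PT.cellBits {f : γ → Cell} (hf : PT f) : PT fun x => cellBits (f x) :=
  hf.congr_enc fun _ => rfl

@[fun_prop]
theorem PT.cellEq {f g : γ → Cell} (hf : PT f) (hg : PT g) : PT fun x => cellEq (f x) (g x) := by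
  unfold PolyProg.cellEq
  fun_prop

/-- Equality of lengths. -/
def lengthEq {α β : Type} (l : List α) (l' : List β) : Bool :=
  (l'.drop l.length).isEmpty && (l.drop l'.length).isEmpty

theorem lengthEq_iff {α β : Type} (l : List α) (l' : List β) :
    lengthEq l l' = true ↔ l.length = l'.length := by
  simp [lengthEq, List.isEmpty_iff, List.drop_eq_nil_iff]
  lia

@[fun_prop]
theorem PT.lengthEq {l : γ → List α} {l' : γ → List β} (hl : PT l) (hl' : PT l') :
    PT fun x => lengthEq (l x) (l' x) :=
  (hl.drop_length hl').isEmpty.and (hl'.drop_length hl).isEmpty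

/-- Equality of strings. -/
def stringEq (l l' : List Cell) : Bool :=
  lengthEq l l' && (l.zip l').all fun p => cellEq p.1 p.2

theorem stringEq_iff (l l' : List Cell) : stringEq l l' = true ↔ l = l' := by
  rw [stringEq, Bool.and_eq_true, lengthEq_iff]
  constructor
  · rintro ⟨h₁, h₂⟩
    induction l generalizing l' with
    | nil => cases l' <;> simp_all
    | cons a l ih =>
      cases l' with
      | nil => simp at h₁
      | cons b l' =>
        simp only [List.zip_cons_cons, List.all_cons, Bool.and_eq_true, cellEq_iff] at h₂
        rw [h₂.1, ih l' (by simpa using h₁) h₂.2]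
  · rintro rfl
    refine ⟨rfl, ?_⟩
    induction l with
    | nil => rfl
    | cons a l ih => simpa [(cellEq_iff a a).mpr rfl] using ih

@[fun_prop]
theorem PT.stringEq {f g : γ → List Cell} (hf : PT f) (hg : PT g) :
    PT fun x => stringEq (f x) (g x) :=
  (hf.lengthEq hg).and (PT.all (f := fun _ (p : Cell × Cell) => PolyProg.cellEq p.1 p.2)
    (by fun_prop) (hf.zip hg))

/-- One step of splitting a string. -/
def tokenStep (a : Cell) (g : Cell) (acc : List (List Cell)) : List (List Cell) :=
  bif cellEq g a then [] :: acc else (g :: acc.headD []) :: acc.tail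

/-- Splits a string after each occurrence of the symbol `a`. -/
def tokens (a : Cell) (l : List Cell) : List (List Cell) := l.foldr (tokenStep a) []

@[fun_prop]
theorem PT.tokens {a : Cell} {f : γ → List Cell} (hf : PT f) : PT fun x => tokens a (f x) := by
  have : PT fun l : List Cell => l.foldr (tokenStep a) [] := by
    refine PT.foldr_size (f := fun _ => tokenStep a) ?_ (.const _) .id' ⟨20, fun c s x => ?_⟩
    · unfold tokenStep
      fun_prop
    · refine (size_cond_le _ _ _).trans ?_
      cases s with
      | nil => simp
      | cons => simp; lia
  exact this.comp hf

theorem tokens_of_notMem {a : Cell} {l : List Cell} (h : a ∉ l) :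
    tokens a l = bif l.isEmpty then [] else [l] := by
  induction l with
  | nil => rfl
  | cons g l ih =>
    have h₁ : cellEq g a = false := by
      rw [Bool.eq_false_iff, ne_eq, cellEq_iff]
      rintro rfl; simp at h
    have h₂ : a ∉ l := fun e => h (List.mem_cons_of_mem _ e)
    have : tokens a (g :: l) = tokenStep a g (tokens a l) := rfl
    rw [this, ih h₂, tokenStep, h₁]
    cases l <;> rfl

theorem tokens_append {a : Cell} {l : List Cell} (h : a ∉ l) (l' : List Cell) :
    tokens a (l ++ a :: l') = l :: tokens a l' := by
  induction l with
  | nil =>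
    have : tokens a ([] ++ a :: l') = tokenStep a a (tokens a l') := rfl
    rw [this, tokenStep, (cellEq_iff a a).mpr rfl]; rfl
  | cons g l ih =>
    have h₁ : cellEq g a = false := by
      rw [Bool.eq_false_iff, ne_eq, cellEq_iff]
      rintro rfl; simp at h
    have h₂ : a ∉ l := fun e => h (List.mem_cons_of_mem _ e)
    have : tokens a (g :: l ++ a :: l') = tokenStep a g (tokens a (l ++ a :: l')) := rfl
    rw [this, ih h₂, tokenStep, h₁]; rfl

/-- Appends a digit to a number. -/
def digitStep (g : Cell) (n : ℕ) : ℕ :=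
  match g with
  | some (.bit b) => Nat.bit b n
  | _ => n

@[fun_prop]
theorem PT.digitStep {g : γ → Cell} {n : γ → ℕ} (hg : PT g) (hn : PT n) :
    PT fun x => digitStep (g x) (n x) := by
  refine PT.cellCases (f := fun a x => PolyProg.digitStep a (n x)) (fun a => ?_) hg
  rcases a with _ | _ | _ | _ | _ <;> simp only [PolyProg.digitStep] <;> fun_prop

theorem size_digitStep_le (g : Cell) (n : ℕ) : size (digitStep g n) ≤ size n + 6 := by
  rcases g with _ | b | _ | _ | _ <;> simp only [digitStep, size_bit_le] <;> lia

/-- The number written in a string. -/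
def digits (l : List Cell) : ℕ := l.foldr digitStep 0

/-- The string with given digits. -/
def bitString (l : List Bool) : List Cell := l.map fun b => some (.bit b)

theorem digits_bitString (l : List Bool) : digits (bitString l) = ofBits l := by
  simp [digits, bitString, ofBits, List.foldr_map, digitStep]

@[fun_prop]
theorem PT.digits {l : γ → List Cell} (hl : PT l) : PT fun x => digits (l x) :=
  PT.foldr_size (f := fun _ => PolyProg.digitStep) (by fun_prop) (.const _) hl
    ⟨6, fun c s x => by simpa using size_digitStep_le x s⟩

@[fun_prop]
theorem PT.bitString {l : γ → List Bool} (hl : PT l) : PT fun x => bitString (l x) := by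
  refine PT.map (f := fun _ b => (some (.bit b) : Cell)) ?_ hl
  have : PT fun p : γ × Bool => bif p.2 then (some (.bit true) : Cell) else some (.bit false) := by
    fun_prop
  exact this.congr_fun fun p => by cases p.2 <;> rfl

/-! ### Fractions -/

/-- The triple `(p, n, d)` stands for the fraction `(p - n) / d`. -/
abbrev Frac := ℕ × ℕ × ℕ

/-- The value of a fraction. -/
def val (x : Frac) : ℚ := ((x.1 : ℚ) - x.2.1) / x.2.2

/-- The sum of two fractions. -/
def fracAdd (x y : Frac) : Frac :=
  (x.1 * y.2.2 + y.1 * x.2.2, x.2.1 * y.2.2 + y.2.1 * x.2.2, x.2.2 * y.2.2)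

/-- The product of two fractions. -/
def fracMul (x y : Frac) : Frac :=
  (x.1 * y.1 + x.2.1 * y.2.1, x.1 * y.2.1 + x.2.1 * y.1, x.2.2 * y.2.2)

/-- The comparison of two fractions. -/
def fracLe (x y : Frac) : Bool :=
  decide (x.1 * y.2.2 + y.2.1 * x.2.2 ≤ y.1 * x.2.2 + x.2.1 * y.2.2)

theorem val_fracAdd {x y : Frac} (hx : x.2.2 ≠ 0) (hy : y.2.2 ≠ 0) :
    val (fracAdd x y) = val x + val y := by
  have hx' : (x.2.2 : ℚ) ≠ 0 := by exact_mod_cast hx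
  have hy' : (y.2.2 : ℚ) ≠ 0 := by exact_mod_cast hy
  simp only [val, fracAdd]
  push_cast
  field_simp
  ring

theorem val_fracMul (x y : Frac) : val (fracMul x y) = val x * val y := by
  simp only [val, fracMul]
  push_cast
  rw [div_mul_div_comm]
  congr 1
  ring

theorem fracLe_iff {x y : Frac} (hx : x.2.2 ≠ 0) (hy : y.2.2 ≠ 0) :
    fracLe x y = true ↔ val x ≤ val y := by
  have hx' : (0 : ℚ) < x.2.2 := by exact_mod_cast Nat.pos_of_ne_zero hx
  have hy' : (0 : ℚ) < y.2.2 := by exact_mod_cast Nat.pos_of_ne_zero hy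
  rw [fracLe, decide_eq_true_iff, val, val, div_le_div_iff₀ hx' hy', ← Nat.cast_le (α := ℚ)]
  push_cast
  constructor <;> intro h <;> linarith

@[fun_prop]
theorem PT.fracAdd {f g : γ → Frac} (hf : PT f) (hg : PT g) : PT fun x => fracAdd (f x) (g x) := by
  unfold PolyProg.fracAdd
  fun_prop

@[fun_prop]
theorem PT.fracMul {f g : γ → Frac} (hf : PT f) (hg : PT g) : PT fun x => fracMul (f x) (g x) := by
  unfold PolyProg.fracMul
  fun_prop

@[fun_prop]
theorem PT.fracLe {f g : γ → Frac} (hf : PT f) (hg : PT g) : PT fun x => fracLe (f x) (g x) := by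
  unfold PolyProg.fracLe
  fun_prop

/-- One step of reading a rational number from the right: the state consists of the sign, the number
read last and the denominator. -/
def ratStep (g : Cell) (s : Bool × ℕ × ℕ) : Bool × ℕ × ℕ :=
  match g with
  | some (.bit b) => (s.1, Nat.bit b s.2.1, s.2.2)
  | some .slash => (s.1, 0, s.2.1)
  | some .minus => (true, s.2)
  | _ => s

/-- Reads a rational number. -/
def readRat (l : List Cell) : Frac :=
  let s := l.foldr ratStep (false, 0, 0)
  (bif s.1 then 0 else s.2.1, bif s.1 then s.2.1 else 0, s.2.2)

@[fun_prop]
theorem PT.readRat {l : γ → List Cell} (hl : PT l) : PT fun x => readRat (l x) := by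
  have : PT fun x => (l x).foldr ratStep (false, 0, 0) := by
    refine PT.foldr_size (f := fun _ => ratStep) ?_ (.const _) hl ⟨6, fun c s x => ?_⟩
    · refine PT.cellCases (f := fun a (p : γ × (Bool × ℕ × ℕ) × Cell) => ratStep a p.2.1)
        (fun a => ?_) (by fun_prop)
      rcases a with _ | _ | _ | _ | _ <;> simp only [ratStep] <;> fun_prop
    · obtain ⟨s, n, d⟩ := s
      have := size_nat 0
      have h₁ := one_le_size d
      rcases x with _ | b | _ | _ | _ <;> simp [ratStep] at *
      · have := size_bit_le b n
        lia
      · lia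
  unfold PolyProg.readRat
  fun_prop

/-- The numbers in a tuple of a certificate: a fraction in lowest terms and a witness of this. -/
abbrev Tuple := Frac × ℕ × ℕ

/-- Tests whether a fraction is in lowest terms, using the witness. -/
def canonical (t : Tuple) : Bool :=
  decide (t.1.1 * t.1.2.1 = 0) && (decide (t.2.1 + 1 ≤ t.1.2.2) &&
    decide (t.2.1 * (t.1.1 + t.1.2.1) + 1 = t.2.2 * t.1.2.2))

/-- The string for a tuple of a certificate. -/
def writeTuple (t : Tuple) : List Cell :=
  bitString t.1.1.bits ++ (some .slash :: (bitString t.1.2.1.bits ++ (some .slash ::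
    (bitString t.1.2.2.bits ++ (some .slash :: (bitString t.2.1.bits ++ (some .slash ::
      (bitString t.2.2.bits ++ [some .slash]))))))))

/-- Reads a tuple of a certificate. -/
def readTuple (l : List Cell) : Tuple :=
  let t := (tokens (some .slash) l).map digits
  ((t.headD 0, t.tail.headD 0, t.tail.tail.headD 0), t.tail.tail.tail.headD 0,
    t.tail.tail.tail.tail.headD 0)

@[fun_prop]
theorem PT.canonical {f : γ → Tuple} (hf : PT f) : PT fun x => canonical (f x) := by
  unfold PolyProg.canonical
  fun_prop

@[fun_prop]
theorem PT.writeTuple {f : γ → Tuple} (hf : PT f) : PT fun x => writeTuple (f x) := by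
  unfold PolyProg.writeTuple
  fun_prop

@[fun_prop]
theorem PT.readTuple {l : γ → List Cell} (hl : PT l) : PT fun x => readTuple (l x) := by
  have : PT fun x => (PolyProg.tokens (some .slash) (l x)).map PolyProg.digits :=
    PT.map (f := fun _ => PolyProg.digits) (by fun_prop) (by fun_prop)
  unfold PolyProg.readTuple
  fun_prop

/-- Reads a certificate. -/
def readCert (l : List Cell) : List Tuple := (tokens (some .sep) l).map readTuple

/-- Writes a certificate. -/
def writeCert (l : List Tuple) : List Cell := l.flatMap fun t => writeTuple t ++ [some .sep]

@[fun_prop]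
theorem PT.readCert {l : γ → List Cell} (hl : PT l) : PT fun x => readCert (l x) :=
  PT.map (f := fun _ => PolyProg.readTuple) (by fun_prop) (by fun_prop)

@[fun_prop]
theorem PT.writeCert {l : γ → List Tuple} (hl : PT l) : PT fun x => writeCert (l x) :=
  PT.flatMap (f := fun _ t => PolyProg.writeTuple t ++ [some LEMMSymbol.sep]) (by fun_prop) hl

/-! ### The verifier -/

/-- Checks the equation of a min variable. -/
def checkMin (blk : List Cell) (X : List Frac) (x : Frac) : Bool :=
  ((blk.zip X).all fun p => !cellEq p.1 symT || fracLe x p.2) &&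
    (blk.zip X).any fun p => cellEq p.1 symT && fracLe p.2 x

/-- Checks the equation of a max variable. -/
def checkMax (blk : List Cell) (X : List Frac) (x : Frac) : Bool :=
  ((blk.zip X).all fun p => !cellEq p.1 symT || fracLe p.2 x) &&
    (blk.zip X).any fun p => cellEq p.1 symT && fracLe x p.2

@[fun_prop]
theorem PT.checkMin {b : γ → List Cell} {X : γ → List Frac} {x : γ → Frac} (hb : PT b) (hX : PT X)
    (hx : PT x) : PT fun c => checkMin (b c) (X c) (x c) := by
  have hx' := hx.comp (f := fun p : γ × Cell × Frac => p.1) (by fun_prop)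
  exact (PT.all (f := fun c (p : Cell × Frac) => !PolyProg.cellEq p.1 symT || PolyProg.fracLe (x c) p.2)
    (by fun_prop) (by fun_prop)).and (PT.any
      (f := fun c (p : Cell × Frac) => PolyProg.cellEq p.1 symT && PolyProg.fracLe p.2 (x c))
      (by fun_prop) (by fun_prop))

@[fun_prop]
theorem PT.checkMax {b : γ → List Cell} {X : γ → List Frac} {x : γ → Frac} (hb : PT b) (hX : PT X)
    (hx : PT x) : PT fun c => checkMax (b c) (X c) (x c) := by
  have hx' := hx.comp (f := fun p : γ × Cell × Frac => p.1) (by fun_prop)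
  exact (PT.all (f := fun c (p : Cell × Frac) => !PolyProg.cellEq p.1 symT || PolyProg.fracLe p.2 (x c))
    (by fun_prop) (by fun_prop)).and (PT.any
      (f := fun c (p : Cell × Frac) => PolyProg.cellEq p.1 symT && PolyProg.fracLe (x c) p.2)
      (by fun_prop) (by fun_prop))

/-- The linear form with given coefficients. -/
def linearForm (blks : List (List Cell)) (X : List Frac) : Frac :=
  (blks.zip X).foldl (fun acc p => fracAdd acc (fracMul (readRat p.1) p.2)) (0, 0, 1)

/-- The maximal number of binary digits in a fraction. -/
def fracSize (x : Frac) : ℕ := max x.1.size (max x.2.1.size x.2.2.size)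

/-- This is the additive growth that `PT.foldl` needs for sums of fractions. The maximum of the
three bit lengths is the right measure because cross-multiplication mixes the components: a long
denominator lengthens the numerators too, so the total size may grow by a factor. -/
theorem fracSize_fracAdd_le (x y : Frac) : fracSize (fracAdd x y) ≤ fracSize x + (fracSize y + 1) := by
  obtain ⟨a, b, c⟩ := x
  obtain ⟨a', b', c'⟩ := y
  have h₁ := natSize_add_le (a * c') (a' * c)
  have h₂ := natSize_add_le (b * c') (b' * c)
  have := natSize_mul_le a c'
  have := natSize_mul_le a' c
  have := natSize_mul_le b c'
  have := natSize_mul_le b' c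
  have := natSize_mul_le c c'
  simp only [fracSize, fracAdd]
  lia

theorem fracSize_le_size (x : Frac) : fracSize x ≤ size x := by
  obtain ⟨a, b, c⟩ := x
  simp [fracSize, size_nat]
  lia

theorem size_le_fracSize (x : Frac) : size x ≤ 18 * fracSize x + 5 := by
  obtain ⟨a, b, c⟩ := x
  simp [fracSize, size_nat]
  lia

@[fun_prop]
theorem PT.linearForm {b : γ → List (List Cell)} {X : γ → List Frac} (hb : PT b) (hX : PT X) :
    PT fun c => linearForm (b c) (X c) := by
  have hterm : PT fun p : List Cell × Frac => PolyProg.fracMul (PolyProg.readRat p.1) p.2 := by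
    fun_prop
  obtain ⟨q, hq⟩ := hterm.size_le
  refine PT.foldl (f := fun _ (acc : Frac) (p : List Cell × Frac) =>
    PolyProg.fracAdd acc (PolyProg.fracMul (PolyProg.readRat p.1) p.2)) (by fun_prop) (.const _)
    (by fun_prop) fracSize ⟨.X, fun s => by simpa using fracSize_le_size s⟩
    ⟨18 * .X + 5, fun s => by simpa using size_le_fracSize s⟩ ⟨q + 1, fun c s x => ?_⟩
  refine (fracSize_fracAdd_le _ _).trans (Nat.add_le_add_left ?_ _)
  have h₁ := fracSize_le_size (PolyProg.fracMul (PolyProg.readRat x.1) x.2)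
  have h₂ := (hq x).trans (eval_mono q (Nat.le_add_left (size x) (size c)))
  simp only [Polynomial.eval_add, Polynomial.eval_one]
  lia

/-- Checks the equation of an affine variable. -/
def checkAffine (blks : List (List Cell)) (X : List Frac) (x : Frac) : Bool :=
  fracLe x (fracAdd (linearForm blks X) (readRat ((blks.drop X.length).headD []))) &&
    fracLe (fracAdd (linearForm blks X) (readRat ((blks.drop X.length).headD []))) x

@[fun_prop]
theorem PT.checkAffine {b : γ → List (List Cell)} {X : γ → List Frac} {x : γ → Frac} (hb : PT b)
    (hX : PT X) (hx : PT x) : PT fun c => checkAffine (b c) (X c) (x c) := by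
  have := hX.drop_length hb
  unfold PolyProg.checkAffine
  fun_prop

/-- Checks one equation. The state consists of the remaining blocks of the input and the result of
the previous checks, and `k` says whether the variable is affine, and whether it is a max variable. -/
def checkStep (X : List Frac) (s : List (List Cell) × Bool) (k : (Bool × Bool) × Frac) :
    List (List Cell) × Bool :=
  bif k.1.1 then ((s.1.drop X.length).tail, s.2 && checkAffine s.1 X k.2)
  else (s.1.tail, s.2 && bif k.1.2 then checkMax (s.1.headD []) X k.2
    else checkMin (s.1.headD []) X k.2)

/-- Checks all equations. -/
def checkRows (kinds : List (Bool × Bool)) (blks : List (List Cell)) (X : List Frac) : Bool :=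
  ((kinds.zip X).foldl (checkStep X) (blks, true)).2

theorem size_drop_le (l : List α) (k : ℕ) : size (l.drop k) ≤ size l := by
  have h := size_append (l.take k) (l.drop k)
  have := one_le_size (l.take k)
  rw [List.take_append_drop] at h
  lia

@[fun_prop]
theorem PT.checkRows {k : γ → List (Bool × Bool)} {b : γ → List (List Cell)} {X : γ → List Frac}
    (hk : PT k) (hb : PT b) (hX : PT X) : PT fun c => checkRows (k c) (b c) (X c) := by
  have : PT fun c => ((k c).zip (X c)).foldl (checkStep (X c)) (b c, true) := by
    refine PT.foldl_size (f := fun c => checkStep (X c)) ?_ (by fun_prop) (by fun_prop)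
      ⟨0, fun c s x => ?_⟩
    · have hX' := hX.comp
        (f := fun p : γ × (List (List Cell) × Bool) × (Bool × Bool) × Frac => p.1) (by fun_prop)
      have := hX'.drop_length
        (l' := fun p : γ × (List (List Cell) × Bool) × (Bool × Bool) × Frac => p.2.1.1) (by fun_prop)
      unfold checkStep
      fun_prop
    · obtain ⟨l, s⟩ := s
      refine (size_cond_le _ _ _).trans ?_
      have h₁ := size_tail_le l
      have h₂ := size_tail_le (l.drop (X c).length)
      have h₃ := size_drop_le l (X c).length
      simp at *
      lia
  exact this.snd'

/-- The blocks of the instance. -/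
def instanceBlocks (s : List Cell) : List (List Cell) :=
  tokens (some .sep) ((tokens none s).headD [])

/-- The certificate. -/
def certificate (s : List Cell) : List Cell := (tokens none s).tail.headD []

/-- The kinds of the variables: whether a variable is affine, and whether it is a max variable. -/
def kinds {α : Type} (l₁ l₂ l : List α) : List (Bool × Bool) :=
  (l₁.map fun _ => (false, false)) ++ ((l₂.map fun _ => (false, true)) ++
    (l.map fun _ => (true, false)))

/-- The last check of the verifier, comparing a variable with the threshold. -/
def checkThreshold (neg : Bool) (i : List Cell) (b : List Cell) (X : List Frac) : Bool :=
  neg ^^ !fracLe (readRat b) ((X.drop i.length).headD (0, 0, 1))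

/-- The verifier for given blocks of the instance and a given certificate. -/
def verifyBlocks (neg : Bool) (t : List (List Cell)) (w : List Cell) : Bool :=
  stringEq (writeCert (readCert w)) w && ((readCert w).all canonical &&
    (lengthEq (t.tail.tail.headD []) (readCert w) &&
      (checkRows (kinds (t.headD []) (t.tail.headD []) (t.tail.tail.headD []))
        t.tail.tail.tail.tail.tail ((readCert w).map Prod.fst) &&
        checkThreshold neg (t.tail.tail.tail.headD []) (t.tail.tail.tail.tail.headD [])
          ((readCert w).map Prod.fst))))

/-- The verifier. -/
def verify (neg : Bool) (s : List Cell) : Bool :=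
  verifyBlocks neg (instanceBlocks s) (certificate s)

@[fun_prop]
theorem PT.kinds {l₁ l₂ l : γ → List α} (h₁ : PT l₁) (h₂ : PT l₂) (h : PT l) :
    PT fun x => kinds (l₁ x) (l₂ x) (l x) :=
  (PT.map (f := fun _ _ => (false, false)) (by fun_prop) h₁).append
    ((PT.map (f := fun _ _ => (false, true)) (by fun_prop) h₂).append
      (PT.map (f := fun _ _ => (true, false)) (by fun_prop) h))

@[fun_prop]
theorem PT.checkThreshold {neg : Bool} {i b : γ → List Cell} {X : γ → List Frac} (hi : PT i)
    (hb : PT b) (hX : PT X) : PT fun x => checkThreshold neg (i x) (b x) (X x) := by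
  have := hi.drop_length hX
  unfold PolyProg.checkThreshold
  fun_prop

@[fun_prop]
theorem PT.verifyBlocks {neg : Bool} {t : γ → List (List Cell)} {w : γ → List Cell} (ht : PT t)
    (hw : PT w) : PT fun x => verifyBlocks neg (t x) (w x) := by
  have h₁ : PT fun x => (PolyProg.readCert (w x)).all PolyProg.canonical :=
    PT.all (f := fun _ => PolyProg.canonical) (by fun_prop) (by fun_prop)
  have h₂ : PT fun x => (PolyProg.readCert (w x)).map Prod.fst :=
    PT.map (f := fun _ => Prod.fst) (by fun_prop) (by fun_prop)
  unfold PolyProg.verifyBlocks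
  fun_prop

theorem PT.verify (neg : Bool) : PT (verify neg) := by
  unfold PolyProg.verify instanceBlocks certificate
  fun_prop

end PolyProg

/-! ### From polynomial-time programs to Turing machines -/

instance : Finite LEMMSymbol := by
  refine Finite.of_surjective (fun x : Fin 5 => match x with
    | 0 => LEMMSymbol.bit false
    | 1 => .bit true
    | 2 => .minus
    | 3 => .slash
    | 4 => .sep) fun y => ?_
  rcases y with (_ | _) | _ | _ | _
  exacts [⟨0, rfl⟩, ⟨1, rfl⟩, ⟨2, rfl⟩, ⟨3, rfl⟩, ⟨4, rfl⟩]

noncomputable instance : Fintype LEMMSymbol := Fintype.ofFinite _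

namespace PolyProg

open Function (update)
open StackProg Turing

/-- Pushes the tree of a symbol and an inner node. -/
def pushCell : Option Cell → Prog
  | some g => .seq (pushAll (cd g)) (.push 0 symT)
  | none => .skip

/-- Converts the string on stack `2` to a tree on stack `0`. -/
def load : Prog :=
  .seq (.loop 2 Option.isSome (.popCase 2 (pushOpt 1)))
    (.seq (.push 0 symF) (.loop 1 Option.isSome (.popCase 1 pushCell)))

theorem runs_load (s : List Cell) : Runs load (24 * s.length + 3) (st [] [] s) (st (cd s) [] []) := by
  have h₁ : ∀ s b : List Cell, Runs (.loop 2 Option.isSome (.popCase 2 (pushOpt 1)))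
      (3 * s.length + 1) (st [] b s) (st [] (s.reverse ++ b) []) := by
    intro s
    induction s with
    | nil => intro b; exact .loop_done rfl
    | cons a s ih =>
      intro b
      refine (Runs.loop_step (m := 2) rfl (.popCase (.push _ _ _)) (n := 3 * s.length + 1) ?_).mono
        (by simp; lia)
      simpa using ih (a :: b)
  have h₂ : ∀ b s : List Cell, Runs (.loop 1 Option.isSome (.popCase 1 pushCell))
      (21 * b.length + 1) (st (cd s) b []) (st (cd (b.reverse ++ s)) [] []) := by
    intro b
    induction b with
    | nil => intro s; exact .loop_done rfl
    | cons a b ih =>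
      intro s
      have hp : Runs (pushCell (some a)) 19 (st (cd s) b []) (st (cd (a :: s)) b []) := by
        have : (cd a).length = 17 := size_cell a
        exact ((runs_pushAll (cd a) (cd s) b []).seq (runs_push_st _ _ _ _)).mono (by lia)
      refine (Runs.loop_step (m := 20) rfl (.popCase (n := 19) (S' := st (cd (a :: s)) b [])
        (by simpa using hp)) (ih (a :: s))).mono (by simp; lia) |> cast (congrArg _ ?_)
      simp
  have h₃ := h₂ s.reverse []
  have h₄ := h₁ s []
  simp only [List.append_nil, List.reverse_reverse, List.length_reverse] at h₃ h₄
  exact (h₄.seq ((runs_push_st _ _ _ _).seq h₃)).mono (by lia)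

theorem size_string (s : List Cell) : size s = 18 * s.length + 1 := by
  induction s with
  | nil => rfl
  | cons a s ih => simp [ih]; lia

/-- The last statement of the machine moves the result to the output stack. -/
def output (Λ : Type) : TM2.Stmt (Sym (Fin 3) Cell) Λ (Option Cell) :=
  .pop (some 0) (fun v _ => v) (.pop (some 0) (fun _ o => o) (.pop (some 0) (fun v _ => v)
    (.pop (some 0) (fun v _ => v) (.pop (some 0) (fun v _ => v)
      (.push none (fun v => isT v) (.load (fun _ => none) .halt))))))

/-- The machine executing a program on an input string and returning a boolean. -/
noncomputable def machine (c : Prog) : FinTM2 where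
  K := Option (Fin 3)
  k₀ := some 2
  k₁ := none
  Γ := Sym (Fin 3) Cell
  Λ := Option c.Lab
  main := some c.entry
  ΛFin := by
    have := finite_lab c
    exact Fintype.ofFinite _
  σ := Option Cell
  initialState := none
  Γk₀Fin := inferInstanceAs (Fintype (Option LEMMSymbol))
  m
    | none => output _
    | some l => c.compile some none l

/-- Of the five symbols of a boolean, only the second is kept in the register; it determines the
output symbol. The register is then reset, as the halting configuration prescribes. -/
theorem step_output {Λ : Type} (b : Bool) (v : Option Cell) :
    TM2.stepAux (output Λ) v (withOutput (st (cd b) [] [])) =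
      ⟨none, none, update (withOutput (st [] [] [])) none [b]⟩ := by
  cases b <;>
  · simp only [output, TM2.stepAux]
    congr 1
    funext k
    rcases k with _ | k
    · rfl
    · fin_cases k <;> rfl

theorem initList_machine (c : Prog) (s : List Cell) :
    initList (machine c) s = ⟨some (some c.entry), none, withOutput (st [] [] s)⟩ := by
  unfold initList
  congr 1
  funext k
  rcases k with _ | k
  · rfl
  · fin_cases k <;> rfl

/-- The time is that of converting the string to a tree, plus that of the program on a tree of size
18·length + 1, plus one step for the output. -/
theorem PT.nonempty_tm2 {α : Type} (ea : α → List Cell) {f : List Cell → Bool} (hf : PT f) :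
    Nonempty (TM2ComputableInPolyTime ea Computability.encodeBool fun a => f (ea a)) := by
  obtain ⟨c, p, hf⟩ := hf
  refine ⟨{ tm := machine (.seq load c)
            inputAlphabet := Equiv.refl Cell
            outputAlphabet := Equiv.refl Bool
            time := 24 * .X + p.comp (18 * .X + 1) + 4
            outputsFun := fun a => Classical.choice ?_ }⟩
  obtain ⟨t, ht, h⟩ := (runs_load (ea a)).seq (by simpa using (hf (ea a)).2 [] [] [])
  obtain ⟨v, hv⟩ := h.run_compile (machine (.seq load c)).m some none (fun _ => rfl) none
  refine ⟨⟨⟨t + 1, ?_⟩, ?_⟩⟩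
  · have e := (run_add hv (t := 1)).trans (run_one _ _ _ _)
    have e' : (machine (load.seq c)).m none = output _ := rfl
    rw [e', step_output] at e
    have hi : (initList (machine (load.seq c)) (List.map (Equiv.refl Cell).invFun (ea a))) =
        ⟨some (some (load.seq c).entry), none, withOutput (st [] [] (ea a))⟩ := by
      have : List.map (Equiv.refl Cell).invFun (ea a) = ea a := List.map_id _
      exact (congrArg (initList (machine (load.seq c))) this).trans (initList_machine _ _)
    rw [hi]
    refine e.trans ?_
    rw [Option.map_some]
    congr 1
    unfold haltList
    congr 1
    funext k
    rcases k with _ | k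
    · rfl
    · fin_cases k <;> rfl
  · simp only [Polynomial.eval_add, Polynomial.eval_mul, Polynomial.eval_ofNat, Polynomial.eval_X,
      Polynomial.eval_comp, Polynomial.eval_one, ← size_string]
    lia

end PolyProg

namespace PolyProg

/-! ### Certificates -/

theorem canonical_iff (t : Tuple) : canonical t = true ↔
    t.1.1 * t.1.2.1 = 0 ∧ t.2.1 < t.1.2.2 ∧ t.2.1 * (t.1.1 + t.1.2.1) + 1 = t.2.2 * t.1.2.2 := by
  simp only [canonical, Bool.and_eq_true, decide_eq_true_eq, Nat.lt_iff_add_one_le]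

theorem canonical_den_ne_zero {t : Tuple} (h : canonical t = true) : t.1.2.2 ≠ 0 := by
  rw [canonical_iff] at h
  lia

theorem coprime_of_mul_add_one {u v N d : ℕ} (h : u * N + 1 = v * d) : Nat.Coprime N d := by
  have h₁ : N.gcd d ∣ u * N + 1 := h ▸ (Nat.gcd_dvd_right N d).mul_left v
  exact Nat.dvd_one.mp ((Nat.dvd_add_right ((Nat.gcd_dvd_left N d).mul_left u)).mp h₁)

/-- The equation u(p + n) + 1 = vd forces lowest terms, so equal values have equal numerators and
denominators; as one of p, n is 0, the difference p - n determines both. The range condition u < d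
then fixes u, and v follows. -/
theorem canonical_injective {s t : Tuple} (hs : canonical s = true) (ht : canonical t = true)
    (h : val s.1 = val t.1) : s = t := by
  rw [canonical_iff] at hs ht
  obtain ⟨⟨p, n, d⟩, u, v⟩ := s
  obtain ⟨⟨p', n', d'⟩, u', v'⟩ := t
  simp only [val] at *
  obtain ⟨h₁, h₂, h₃⟩ := hs
  obtain ⟨h₁', h₂', h₃'⟩ := ht
  have abs : ∀ {p n : ℕ}, p * n = 0 → ((p : ℤ) - n).natAbs = p + n := by
    intro p n h
    rcases Nat.mul_eq_zero.mp h with rfl | rfl <;> simp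
  have key := Rat.div_int_inj (a := (p : ℤ) - n) (b := d) (c := (p' : ℤ) - n') (d := d')
    (by lia) (by lia) (by rw [abs h₁]; exact coprime_of_mul_add_one h₃)
    (by rw [abs h₁']; exact coprime_of_mul_add_one h₃') (by push_cast; exact_mod_cast h)
  obtain ⟨k₁, k₂⟩ := key
  have hd : d = d' := by exact_mod_cast k₂
  have hp : p = p' ∧ n = n' := by
    rcases Nat.mul_eq_zero.mp h₁ with rfl | rfl <;> rcases Nat.mul_eq_zero.mp h₁' with rfl | rfl <;>
      lia
  obtain ⟨rfl, rfl⟩ := hp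
  subst hd
  -- Subtracting the two witness equations shows that d divides (u - u')(p + n), hence u - u', whose
  -- absolute value is less than d.
  have hu : u = u' := by
    have hc : IsCoprime (d : ℤ) ((p + n : ℕ) : ℤ) :=
      (Nat.isCoprime_iff_coprime.mpr (coprime_of_mul_add_one h₃)).symm
    have hdvd : (d : ℤ) ∣ ((u : ℤ) - u') * ((p + n : ℕ) : ℤ) := by
      refine ⟨(v : ℤ) - v', ?_⟩
      zify at h₃ h₃'
      push_cast
      linear_combination h₃ - h₃'
    have h₄ := Int.eq_zero_of_abs_lt_dvd (hc.dvd_of_dvd_mul_right hdvd) (by rw [abs_lt]; lia)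
    lia
  subst hu
  have hv : v = v' := Nat.eq_of_mul_eq_mul_right (by lia : 0 < d) (h₃.symm.trans h₃')
  rw [hv]

theorem exists_canonical (q : ℚ) : ∃ t : Tuple, canonical t = true ∧ val t.1 = q ∧
    t.1.1 ≤ q.num.natAbs ∧ t.1.2.1 ≤ q.num.natAbs ∧ t.1.2.2 = q.den ∧ t.2.1 ≤ q.den ∧
    t.2.2 ≤ q.num.natAbs + 1 := by
  have hd : q.den ≠ 0 := q.den_ne_zero
  have : NeZero q.den := ⟨hd⟩
  have hN : q.num.toNat + (-q.num).toNat = q.num.natAbs := by lia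
  -- The witness is the residue of -1/N modulo d, where N is the absolute numerator, so that d
  -- divides uN + 1.
  obtain ⟨u, hu⟩ : ∃ u, u = (-((q.num.natAbs : ZMod q.den))⁻¹).val := ⟨_, rfl⟩
  have hlt : u < q.den := by rw [hu]; exact ZMod.val_lt _
  have hdvd : q.den ∣ u * q.num.natAbs + 1 := by
    rw [← ZMod.natCast_eq_zero_iff]
    push_cast
    rw [hu, ZMod.natCast_zmod_val]
    have := ZMod.coe_mul_inv_eq_one q.num.natAbs q.reduced
    linear_combination -this
  obtain ⟨v, hv⟩ := hdvd
  refine ⟨((q.num.toNat, (-q.num).toNat, q.den), u, v), ?_, ?_,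
    show q.num.toNat ≤ _ by lia, show (-q.num).toNat ≤ _ by lia, rfl,
    hlt.le, ?_⟩
  · rw [canonical_iff]
    refine ⟨?_, hlt, ?_⟩
    · rw [Nat.mul_eq_zero]
      change q.num.toNat = 0 ∨ (-q.num).toNat = 0
      lia
    · simp only [hN]
      rw [hv, mul_comm]
  · simp only [val]
    have : ((q.num.toNat : ℚ) - (-q.num).toNat) = q.num := by
      have : ((q.num.toNat : ℤ) - (-q.num).toNat) = q.num := by lia
      exact_mod_cast this
    rw [this, Rat.num_div_den]
  · simp only
    -- If v ≥ N + 2, then d(N + 2) ≤ vd = uN + 1 ≤ dN + 1, which is impossible for d ≥ 1.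
    by_contra! hlt'
    have h₁ : q.den * (q.num.natAbs + 2) ≤ q.den * v := Nat.mul_le_mul_left _ (by lia)
    have h₂ : u * q.num.natAbs ≤ q.den * q.num.natAbs := Nat.mul_le_mul_right _ hlt.le
    rw [← hv, mul_add] at h₁
    lia

/-- The tuple representing a rational number in certificates. -/
noncomputable def tupleOf (q : ℚ) : Tuple := (exists_canonical q).choose

theorem canonical_tupleOf (q : ℚ) : canonical (tupleOf q) = true :=
  (exists_canonical q).choose_spec.1

theorem val_tupleOf (q : ℚ) : val (tupleOf q).1 = q :=
  (exists_canonical q).choose_spec.2.1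

theorem tupleOf_val {t : Tuple} (h : canonical t = true) : tupleOf (val t.1) = t :=
  canonical_injective (canonical_tupleOf _) h (val_tupleOf _)

theorem notMem_bitString {a : Cell} (h : isBit (some a) = false) (l : List Bool) :
    a ∉ bitString l := by
  intro ha
  obtain ⟨b, _, rfl⟩ := List.mem_map.mp ha
  simp [isBit] at h

theorem readTuple_writeTuple (t : Tuple) : readTuple (writeTuple t) = t := by
  have h := notMem_bitString (a := some .slash) rfl
  have h' : tokens (some .slash) (writeTuple t) = [bitString t.1.1.bits, bitString t.1.2.1.bits,
      bitString t.1.2.2.bits, bitString t.2.1.bits, bitString t.2.2.bits] := by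
    unfold writeTuple
    rw [tokens_append (h _), tokens_append (h _), tokens_append (h _), tokens_append (h _),
      tokens_append (h _)]
    rfl
  simp [readTuple, h', digits_bitString, ofBits_bits]

theorem sep_notMem_writeTuple (t : Tuple) : some .sep ∉ writeTuple t := by
  have h := notMem_bitString (a := some .sep) rfl
  simp [writeTuple, h]

theorem readCert_writeCert (T : List Tuple) : readCert (writeCert T) = T := by
  induction T with
  | nil => rfl
  | cons t T ih =>
    have : writeCert (t :: T) = writeTuple t ++ some .sep :: writeCert T := by
      simp [writeCert]
    rw [readCert, this, tokens_append (sep_notMem_writeTuple t), List.map_cons,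
      readTuple_writeTuple]
    exact congrArg _ ih

/-! ### Reading the instance -/

open LEMMInstance LEMMSymbol

/-- The string `s` consists of the blocks `bs`, each of them followed by a separator. -/
def IsBlocks (s : List LEMMSymbol) (bs : List (List Cell)) : Prop :=
  ∀ rest : List LEMMSymbol, tokens (some sep) ((s ++ rest).map some) =
    bs ++ tokens (some sep) (rest.map some)

theorem IsBlocks.tokens_eq {s bs} (h : IsBlocks s bs) : tokens (some sep) (s.map some) = bs := by
  simpa [tokens] using h []

/-- Parsing is compositional because `IsBlocks` allows an arbitrary continuation of the string. -/
theorem IsBlocks.append {s s' bs bs'} (h : IsBlocks s bs) (h' : IsBlocks s' bs') :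
    IsBlocks (s ++ s') (bs ++ bs') := by
  intro rest
  rw [List.append_assoc, h, h', List.append_assoc]

theorem IsBlocks.nil : IsBlocks [] [] := fun _ => rfl

theorem IsBlocks.flatMap {α : Type} {f : α → List LEMMSymbol} {g : α → List (List Cell)}
    (h : ∀ a, IsBlocks (f a) (g a)) (l : List α) : IsBlocks (l.flatMap f) (l.flatMap g) := by
  induction l with
  | nil => exact .nil
  | cons a l ih =>
    rw [List.flatMap_cons, List.flatMap_cons]
    exact (h a).append ih

theorem IsBlocks.single {s : List LEMMSymbol} (h : sep ∉ s) :
    IsBlocks (s ++ [sep]) [s.map some] := by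
  intro rest
  rw [List.append_assoc, List.map_append]
  have h' : some sep ∉ s.map some := by simpa using h
  exact tokens_append h' _

/-- The string of a rational number without the separator. -/
def ratString (r : ℚ) : List LEMMSymbol :=
  (if r < 0 then [minus] else []) ++ r.num.natAbs.bits.map bit ++ [slash] ++ r.den.bits.map bit

theorem isBlocks_encodeRat (r : ℚ) : IsBlocks (encodeRat r) [(ratString r).map some] := by
  refine IsBlocks.single (s := ratString r) ?_
  unfold ratString
  split_ifs <;> simp

theorem isBlocks_encodeUnary (m : ℕ) :
    IsBlocks (encodeUnary m) [(List.replicate m (bit true)).map some] :=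
  IsBlocks.single (by simp)

theorem foldr_ratStep_bits (l : List Bool) (s : Bool × ℕ × ℕ) :
    ((l.map bit).map some).foldr ratStep s = (s.1, l.foldr Nat.bit s.2.1, s.2.2) := by
  induction l with
  | nil => rfl
  | cons b l ih =>
    rw [List.map_cons, List.map_cons, List.foldr_cons, ih]
    rfl

theorem readRat_ratString (r : ℚ) : (readRat ((ratString r).map some)).2.2 ≠ 0 ∧
    val (readRat ((ratString r).map some)) = r := by
  have h : ((ratString r).map some).foldr ratStep (false, 0, 0) =
      (decide (r < 0), r.num.natAbs, r.den) := by
    unfold ratString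
    rw [List.map_append, List.map_append, List.map_append, List.foldr_append, List.foldr_append,
      List.foldr_append, foldr_ratStep_bits]
    have e₁ : List.foldr Nat.bit 0 r.den.bits = r.den := ofBits_bits _
    have e₂ : List.foldr Nat.bit 0 r.num.natAbs.bits = r.num.natAbs := ofBits_bits _
    simp only [List.map_cons, List.map_nil, List.foldr_cons, List.foldr_nil]
    rw [foldr_ratStep_bits]
    simp only [ratStep, e₂]
    split_ifs with h <;> simpa [ratStep, h] using e₁
  simp only [readRat, h, val]
  refine ⟨r.den_ne_zero, ?_⟩
  conv_rhs => rw [← Rat.num_div_den r]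
  congr 1
  by_cases hr : r < 0
  · have h₁ : r.num < 0 := Rat.num_neg.mpr hr
    have h₂ : (r.num.natAbs : ℤ) = - r.num := by lia
    have h₃ : (r.num.natAbs : ℚ) = - r.num := by
      rw [← Int.cast_natCast, h₂, Int.cast_neg]
    simp [hr, h₃]
  · have h₁ : 0 ≤ r.num := Rat.num_nonneg.mpr (not_lt.mp hr)
    have h₂ : (r.num.natAbs : ℤ) = r.num := by lia
    have h₃ : (r.num.natAbs : ℚ) = r.num := by rw [← Int.cast_natCast, h₂]
    simp [hr, h₃]

/-- The blocks of an equation. -/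
def rowBlocks (L : LEMM ℚ) (r : Fin L.n) : List (List Cell) :=
  if h : (r : ℕ) < L.n₁ + L.n₂ then
    [(List.finRange L.n).map fun l => some (bit (decide (l ∈ L.J r h)))]
  else
    ((List.finRange L.n).map fun l => (ratString (L.q r (not_lt.mp h) l)).map some) ++
      [(ratString (L.b r (not_lt.mp h))).map some]

theorem isBlocks_encodeRow (L : LEMM ℚ) (r : Fin L.n) :
    IsBlocks (encodeRow L r) (rowBlocks L r) := by
  unfold encodeRow rowBlocks
  split_ifs with h
  · have := IsBlocks.single
      (s := (List.finRange L.n).map fun l => bit (decide (l ∈ L.J r h))) (by simp)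
    simpa [Function.comp_def] using this
  · refine IsBlocks.append ?_ (isBlocks_encodeRat _)
    have := IsBlocks.flatMap (fun l => isBlocks_encodeRat (L.q r (not_lt.mp h) l))
      (List.finRange L.n)
    rwa [List.map_eq_flatMap]

theorem isBlocks_encode (I : LEMMInstance) : IsBlocks I.encode
    ((List.replicate I.L.n₁ (bit true)).map some :: (List.replicate I.L.n₂ (bit true)).map some ::
      (List.replicate I.L.n (bit true)).map some :: (List.replicate I.i (bit true)).map some ::
      (ratString I.β).map some :: (List.finRange I.L.n).flatMap (rowBlocks I.L)) :=
  (((((isBlocks_encodeUnary _).append (isBlocks_encodeUnary _)).append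
    (isBlocks_encodeUnary _)).append (isBlocks_encodeUnary _)).append
    (isBlocks_encodeRat _)).append (IsBlocks.flatMap (isBlocks_encodeRow I.L) _)

theorem tokens_encodePair (s w : List LEMMSymbol) :
    (tokens none (s.map some ++ none :: w.map some)).headD [] = s.map some ∧
    certificate (s.map some ++ none :: w.map some) = w.map some := by
  have h : ∀ l : List LEMMSymbol, (none : Cell) ∉ l.map some := by simp
  rw [certificate, tokens_append (h s), tokens_of_notMem (h w)]
  refine ⟨rfl, ?_⟩
  -- An empty certificate produces no token at all; the default value `[]` is then the correct
  -- result.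
  cases w <;> rfl

end PolyProg

/-! ### Correctness of the verifier -/

/-- The equation number `r` of a rational system holds for `x`. -/
def LEMM.RowHolds (L : LEMM ℚ) (x : Fin L.n → ℚ) (r : Fin L.n) : Prop :=
  if h : (r : ℕ) < L.n₁ + L.n₂ then
    if (r : ℕ) < L.n₁ then (∀ l ∈ L.J r h, x r ≤ x l) ∧ ∃ l ∈ L.J r h, x l ≤ x r
    else (∀ l ∈ L.J r h, x l ≤ x r) ∧ ∃ l ∈ L.J r h, x r ≤ x l
  else x r = ∑ l, L.q r (not_lt.mp h) l * x l + L.b r (not_lt.mp h)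

/-- A minimum is a lower bound that is attained, and dually for a maximum. In this form the
equations consist of comparisons only, which the embedding of ℚ into ℝ preserves and reflects. -/
theorem LEMM.isFeasible_toReal_iff (L : LEMM ℚ) (x : Fin L.n → ℚ) :
    L.toReal.IsFeasible (fun j => (x j : ℝ)) ↔ ∀ r, L.RowHolds x r := by
  constructor
  · rintro ⟨h₁, h₂, h₃⟩ r
    unfold LEMM.RowHolds
    split_ifs with h h'
    · have := h₁ r h'
      rw [le_antisymm_iff, Finset.le_inf'_iff, Finset.inf'_le_iff] at this
      have h₄ : (∀ l ∈ L.J r h, (x r : ℝ) ≤ x l) ∧ ∃ l ∈ L.J r h, (x l : ℝ) ≤ x r := this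
      exact_mod_cast h₄
    · have := (h₂ r (not_lt.mp h') h).symm
      rw [le_antisymm_iff, Finset.le_sup'_iff, Finset.sup'_le_iff] at this
      have h₄ : (∀ l ∈ L.J r h, (x l : ℝ) ≤ x r) ∧ ∃ l ∈ L.J r h, (x r : ℝ) ≤ x l := this
      exact_mod_cast h₄
    · have : (x r : ℝ) = ∑ l, (L.q r (not_lt.mp h) l : ℝ) * x l + (L.b r (not_lt.mp h) : ℝ) :=
        h₃ r (not_lt.mp h)
      exact_mod_cast this
  · intro H
    refine ⟨fun (r : Fin L.n) (h : (r : ℕ) < L.n₁) => ?_,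
      fun (r : Fin L.n) (h : L.n₁ ≤ r) (h' : (r : ℕ) < L.n₁ + L.n₂) => ?_,
      fun (r : Fin L.n) (h : L.n₁ + L.n₂ ≤ r) => ?_⟩
    · have := H r
      have h' : (r : ℕ) < L.n₁ + L.n₂ := Nat.lt_add_right L.n₂ h
      rw [LEMM.RowHolds, dif_pos h', if_pos h] at this
      rw [le_antisymm_iff, Finset.le_inf'_iff, Finset.inf'_le_iff]
      have h₄ : (∀ l ∈ L.J r h', (x r : ℝ) ≤ x l) ∧ ∃ l ∈ L.J r h', (x l : ℝ) ≤ x r := by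
        exact_mod_cast this
      exact h₄
    · have := H r
      rw [LEMM.RowHolds, dif_pos h', if_neg (not_lt.mpr h)] at this
      refine Eq.symm ?_
      rw [le_antisymm_iff, Finset.le_sup'_iff, Finset.sup'_le_iff]
      have h₄ : (∀ l ∈ L.J r h', (x l : ℝ) ≤ x r) ∧ ∃ l ∈ L.J r h', (x r : ℝ) ≤ x l := by
        exact_mod_cast this
      exact h₄
    · have := H r
      rw [LEMM.RowHolds, dif_neg (not_lt.mpr h)] at this
      have h' : (x r : ℝ) = ∑ l, (L.q r h l : ℝ) * x l + (L.b r h : ℝ) := by exact_mod_cast this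
      exact h'

namespace PolyProg

open LEMMInstance LEMMSymbol

variable {n : ℕ} {t : Fin n → Frac}

theorem zip_indicator (t : Fin n → Frac) (P : Fin n → Bool) :
    ((List.finRange n).map fun l => (some (bit (P l)) : Cell)).zip ((List.finRange n).map t) =
      (List.finRange n).map fun l => ((some (bit (P l)) : Cell), t l) := by
  rw [List.zip_map']

theorem cellEq_bit (b : Bool) : cellEq (some (bit b)) symT = b := by cases b <;> rfl

theorem checkMin_iff (ht : ∀ r, (t r).2.2 ≠ 0) (P : Fin n → Bool) (r : Fin n) :
    checkMin ((List.finRange n).map fun l => some (bit (P l))) ((List.finRange n).map t) (t r) = true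
      ↔ (∀ l, P l = true → val (t r) ≤ val (t l)) ∧ ∃ l, P l = true ∧ val (t l) ≤ val (t r) := by
  rw [checkMin, zip_indicator]
  simp [cellEq_bit, fracLe_iff (ht _) (ht _), or_iff_not_imp_left]

theorem checkMax_iff (ht : ∀ r, (t r).2.2 ≠ 0) (P : Fin n → Bool) (r : Fin n) :
    checkMax ((List.finRange n).map fun l => some (bit (P l))) ((List.finRange n).map t) (t r) = true
      ↔ (∀ l, P l = true → val (t l) ≤ val (t r)) ∧ ∃ l, P l = true ∧ val (t r) ≤ val (t l) := by
  rw [checkMax, zip_indicator]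
  simp [cellEq_bit, fracLe_iff (ht _) (ht _), or_iff_not_imp_left]

/-- The nonzero denominator is carried through the induction because addition of fractions is
correct only under this condition. -/
theorem foldl_linearForm (ht : ∀ r, (t r).2.2 ≠ 0) (q : Fin n → ℚ) (l : List (Fin n)) (acc : Frac)
    (hacc : acc.2.2 ≠ 0) :
    ((l.map fun j => ((ratString (q j)).map (some : LEMMSymbol → Cell), t j)).foldl
      (fun acc p => fracAdd acc (fracMul (readRat p.1) p.2)) acc).2.2 ≠ 0 ∧
    val ((l.map fun j => ((ratString (q j)).map (some : LEMMSymbol → Cell), t j)).foldl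
      (fun acc p => fracAdd acc (fracMul (readRat p.1) p.2)) acc) =
      val acc + (l.map fun j => q j * val (t j)).sum := by
  induction l generalizing acc with
  | nil => simpa using hacc
  | cons j l ih =>
    have h₁ := readRat_ratString (q j)
    have h₂ : (fracMul (readRat ((ratString (q j)).map some)) (t j)).2.2 ≠ 0 :=
      mul_ne_zero h₁.1 (ht j)
    have h₃ := ih (fracAdd acc (fracMul (readRat ((ratString (q j)).map some)) (t j)))
      (mul_ne_zero hacc h₂)
    rw [val_fracAdd hacc h₂, val_fracMul, h₁.2] at h₃
    rw [List.map_cons, List.map_cons, List.foldl_cons, List.sum_cons, ← add_assoc]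
    exact h₃

theorem linearForm_spec (ht : ∀ r, (t r).2.2 ≠ 0) (q : Fin n → ℚ) (rest : List (List Cell)) :
    (linearForm (((List.finRange n).map fun j => (ratString (q j)).map some) ++ rest)
      ((List.finRange n).map t)).2.2 ≠ 0 ∧
    val (linearForm (((List.finRange n).map fun j => (ratString (q j)).map some) ++ rest)
      ((List.finRange n).map t)) = ∑ j, q j * val (t j) := by
  have h : (((List.finRange n).map fun j => (ratString (q j)).map (some : LEMMSymbol → Cell)) ++
      rest).zip ((List.finRange n).map t) =
      (List.finRange n).map fun j => ((ratString (q j)).map some, t j) := by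
    -- The surplus blocks (constant term and later rows) are paired with the empty list and
    -- disappear.
    rw [← List.append_nil ((List.finRange n).map t), List.zip_append (by simp), List.zip_map']
    simp
  rw [linearForm, h, Fin.sum_univ_def]
  have := foldl_linearForm ht q (List.finRange n) (0, 0, 1) (by simp)
  simpa [val] using this

theorem checkAffine_iff (ht : ∀ r, (t r).2.2 ≠ 0) (q : Fin n → ℚ) (b : ℚ)
    (rest : List (List Cell)) (r : Fin n) :
    checkAffine (((List.finRange n).map fun j => (ratString (q j)).map some) ++
      ((ratString b).map some :: rest)) ((List.finRange n).map t) (t r) = true ↔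
      val (t r) = ∑ j, q j * val (t j) + b := by
  have h₁ := linearForm_spec ht q ((ratString b).map some :: rest)
  have h₂ := readRat_ratString b
  have h₃ := val_fracAdd h₁.1 h₂.1
  have h₄ := mul_ne_zero h₁.1 h₂.1
  rw [h₁.2, h₂.2] at h₃
  have h₅ : ((((List.finRange n).map fun j => (ratString (q j)).map (some : LEMMSymbol → Cell)) ++
      ((ratString b).map some :: rest)).drop ((List.finRange n).map t).length).headD [] =
      (ratString b).map some := by
    rw [List.drop_left' (by simp)]; rfl
  rw [checkAffine, h₅, Bool.and_eq_true, fracLe_iff (ht r) h₄, fracLe_iff h₄ (ht r), h₃,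
    le_antisymm_iff]

/-- The kind of a variable. -/
def kind (n₁ n₂ r : ℕ) : Bool × Bool :=
  if r < n₁ then (false, false) else if r < n₁ + n₂ then (false, true) else (true, false)

/-- Besides testing its equation, a step consumes exactly the blocks of its own row, which keeps the
remaining rows aligned with their variables. -/
theorem checkStep_spec (L : LEMM ℚ) {t : Fin L.n → Frac} (ht : ∀ r, (t r).2.2 ≠ 0)
    (r : Fin L.n) (rest : List (List Cell)) (ok : Bool) :
    (checkStep ((List.finRange L.n).map t) (rowBlocks L r ++ rest, ok)
      (kind L.n₁ L.n₂ r, t r)).1 = rest ∧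
    ((checkStep ((List.finRange L.n).map t) (rowBlocks L r ++ rest, ok)
      (kind L.n₁ L.n₂ r, t r)).2 = true ↔ ok = true ∧ L.RowHolds (fun j => val (t j)) r) := by
  unfold checkStep kind LEMM.RowHolds rowBlocks
  by_cases h₁ : (r : ℕ) < L.n₁
  · have h₂ : (r : ℕ) < L.n₁ + L.n₂ := by lia
    simp only [if_pos h₁, dif_pos h₂, cond_false, Bool.and_eq_true]
    refine ⟨rfl, and_congr_right fun _ => ?_⟩
    exact (checkMin_iff ht (fun l => decide (l ∈ L.J r h₂)) r).trans (by simp)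
  · by_cases h₂ : (r : ℕ) < L.n₁ + L.n₂
    · simp only [if_neg h₁, if_pos h₂, dif_pos h₂, cond_false, cond_true, Bool.and_eq_true]
      refine ⟨rfl, and_congr_right fun _ => ?_⟩
      exact (checkMax_iff ht (fun l => decide (l ∈ L.J r h₂)) r).trans (by simp)
    · simp only [if_neg h₁, if_neg h₂, dif_neg h₂, cond_true, Bool.and_eq_true, List.append_assoc]
      refine ⟨?_, and_congr_right fun _ => ?_⟩
      · rw [List.drop_left' (by simp)]; rfl
      · exact checkAffine_iff ht _ _ rest r

theorem foldl_checkStep (L : LEMM ℚ) {t : Fin L.n → Frac} (ht : ∀ r, (t r).2.2 ≠ 0)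
    (l : List (Fin L.n)) (ok : Bool) :
    ((l.map fun r : Fin L.n => (kind L.n₁ L.n₂ r, t r)).foldl
      (checkStep ((List.finRange L.n).map t)) (l.flatMap (rowBlocks L), ok)).2 = true ↔
      ok = true ∧ ∀ r ∈ l, L.RowHolds (fun j => val (t j)) r := by
  induction l generalizing ok with
  | nil => simp
  | cons r l ih =>
    obtain ⟨h₁, h₂⟩ := checkStep_spec L ht r (l.flatMap (rowBlocks L)) ok
    rw [List.map_cons, List.foldl_cons, List.flatMap_cons]
    rw [← Prod.mk.eta (p := checkStep _ _ _)]
    rw [h₁, ih, h₂]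
    simp [and_assoc]

theorem kinds_zip {α : Type} {n₁ n₂ n : ℕ} {l₁ l₂ l : List α} (h₁ : l₁.length = n₁)
    (h₂ : l₂.length = n₂) (h : l.length = n) (t : Fin n → Frac) :
    (kinds l₁ l₂ l).zip ((List.finRange n).map t) =
      (List.finRange n).map fun r : Fin n => (kind n₁ n₂ r, t r) := by
  refine List.ext_getElem (by simp [kinds]; lia) fun i hi hi' => ?_
  simp only [List.length_map, List.length_finRange] at hi'
  simp only [List.getElem_zip, kinds, List.getElem_append, List.length_map, List.getElem_map, h₁,
    h₂, List.getElem_finRange, Fin.val_cast, kind]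
  congr 1
  split_ifs <;> first | rfl | lia

theorem checkRows_iff (L : LEMM ℚ) {t : Fin L.n → Frac} (ht : ∀ r, (t r).2.2 ≠ 0) {α : Type}
    {l₁ l₂ l : List α} (h₁ : l₁.length = L.n₁) (h₂ : l₂.length = L.n₂) (h : l.length = L.n) :
    checkRows (kinds l₁ l₂ l) ((List.finRange L.n).flatMap (rowBlocks L))
      ((List.finRange L.n).map t) = true ↔ ∀ r, L.RowHolds (fun j => val (t j)) r := by
  rw [checkRows, kinds_zip h₁ h₂ h, foldl_checkStep L ht]
  simp

theorem checkThreshold_iff (neg : Bool) (ht : ∀ r, (t r).2.2 ≠ 0) (i : Fin n) (β : ℚ)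
    {l : List Cell} (hl : l.length = i) :
    checkThreshold neg l ((ratString β).map some) ((List.finRange n).map t) = true ↔
      (neg = true ↔ ¬ val (t i) < β) := by
  have h₁ := readRat_ratString β
  have h₂ : (((List.finRange n).map t).drop l.length).headD (0, 0, 1) = t i := by
    rw [List.headD_eq_head?_getD, List.head?_drop, hl]
    simp
  rw [checkThreshold, h₂]
  have h₃ := fracLe_iff h₁.1 (ht i)
  rw [h₁.2] at h₃
  rw [not_lt, ← h₃]
  cases neg <;> cases fracLe (readRat ((ratString β).map some)) (t i) <;> simp

/-- The certificate of a vector. -/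
noncomputable def certOf (x : Fin n → ℚ) : List Cell :=
  writeCert ((List.finRange n).map fun r => tupleOf (x r))

/-- A rational solution on the right side of the threshold is accepted in exactly one spelling:
re-encoding rules out every string that is not an output of `writeCert`, and `canonical` fixes the
tuple of each coordinate. -/
theorem verify_iff (neg : Bool) (I : LEMMInstance) (w : List LEMMSymbol) :
    verify neg (I.encode.map some ++ none :: w.map some) = true ↔
      ∃ x : Fin I.L.n → ℚ, (∀ r, I.L.RowHolds x r) ∧ (neg = true ↔ ¬ x I.i < I.β) ∧
        w.map some = certOf x := by
  obtain ⟨e₁, e₂⟩ := tokens_encodePair I.encode w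
  -- For a well-formed certificate only the row tests and the threshold remain; both directions
  -- reduce to this case.
  have key : ∀ t : Fin I.L.n → Tuple, (∀ r, canonical (t r) = true) →
      w.map some = writeCert ((List.finRange I.L.n).map t) →
      (verify neg (I.encode.map some ++ none :: w.map some) = true ↔
        (∀ r, I.L.RowHolds (fun j => val (t j).1) r) ∧ (neg = true ↔ ¬ val (t I.i).1 < I.β)) := by
    intro t ht hw
    have hd : ∀ r, (t r).1.2.2 ≠ 0 := fun r => canonical_den_ne_zero (ht r)
    rw [verify, instanceBlocks, e₁, e₂, (isBlocks_encode I).tokens_eq, hw, verifyBlocks,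
      readCert_writeCert]
    simp only [Bool.and_eq_true, stringEq_iff, lengthEq_iff, List.headD_cons, List.tail_cons,
      List.map_map, Function.comp_def]
    rw [checkRows_iff (t := fun r => (t r).1) I.L hd (by simp) (by simp) (by simp),
      checkThreshold_iff (t := fun r => (t r).1) neg hd I.i I.β (by simp)]
    simp [ht]
  constructor
  · intro h
    have h' := h
    rw [verify, e₂, verifyBlocks] at h'
    simp only [instanceBlocks, e₁, (isBlocks_encode I).tokens_eq, Bool.and_eq_true, stringEq_iff,
      lengthEq_iff, List.headD_cons, List.tail_cons] at h'
    obtain ⟨h₁, h₂, h₃, -⟩ := h'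
    simp only [List.length_map, List.length_replicate] at h₃
    obtain ⟨t, ht⟩ : ∃ t : Fin I.L.n → Tuple, readCert (w.map some) = (List.finRange I.L.n).map t := by
      refine ⟨fun r => (readCert (w.map some))[(r : ℕ)]'(by have := r.2; lia), ?_⟩
      refine List.ext_getElem (by simp [h₃]) fun i hi hi' => by simp
    rw [ht] at h₁ h₂
    have hc : ∀ r, canonical (t r) = true := by simpa using h₂
    obtain ⟨k₁, k₂⟩ := (key t hc h₁.symm).mp h
    refine ⟨fun j => val (t j).1, k₁, k₂, ?_⟩
    rw [certOf, ← h₁]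
    simp only [tupleOf_val (hc _)]
  · rintro ⟨x, hx, hi, hw⟩
    refine (key (fun r => tupleOf (x r)) (fun r => canonical_tupleOf _) hw).mpr ?_
    simp only [val_tupleOf]
    exact ⟨hx, hi⟩

end PolyProg

/-! ### Existence and uniqueness of the solution under C1 -/

namespace LEMM

variable (L : LEMM ℝ)

/-- The right hand sides of the equations of the system. -/
noncomputable def rhs (x : Fin L.n → ℝ) (i : Fin L.n) : ℝ :=
  if h : (i : ℕ) < L.n₁ + L.n₂ then
    if (i : ℕ) < L.n₁ then (L.J i h).inf' (L.J_nonempty i h) x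
    else (L.J i h).sup' (L.J_nonempty i h) x
  else ∑ l, L.q i (not_lt.mp h) l * x l + L.b i (not_lt.mp h)

theorem isFeasible_iff (x : Fin L.n → ℝ) : L.IsFeasible x ↔ x = L.rhs x := by
  rw [funext_iff]
  constructor
  · rintro ⟨h₁, h₂, h₃⟩ i
    unfold rhs
    split_ifs with h h'
    · exact h₁ i h'
    · exact h₂ i (not_lt.mp h') h
    · exact h₃ i (not_lt.mp h)
  · intro H
    refine ⟨fun i h => ?_, fun i h h' => ?_, fun i h => ?_⟩
    · have := H i
      rwa [rhs, dif_pos (Nat.lt_add_right L.n₂ h), if_pos h] at this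
    · have := H i
      rwa [rhs, dif_pos h', if_neg (not_lt.mpr h)] at this
    · have := H i
      rwa [rhs, dif_neg (not_lt.mpr h)] at this

/-- The possible rows number `i` of the choice matrices. -/
def rowSet (i : Fin L.n) : Set (Fin L.n → ℝ) :=
  {v | if h : (i : ℕ) < L.n₁ + L.n₂ then ∃ l ∈ L.J i h, v = fun j => if j = l then 1 else 0
    else v = L.q i (not_lt.mp h)}

/-- Rows are chosen independently, so the choice matrices form a product set, and the hull of a
product is the product of the hulls. Convex weights may therefore be selected row by row. -/
theorem choiceMatrices_eq : L.choiceMatrices = Set.pi Set.univ L.rowSet := by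
  ext Q
  constructor
  · rintro ⟨ℓ, hℓ, rfl⟩ i _
    change dite _ _ _
    split_ifs with h
    · exact ⟨ℓ i h, hℓ i h, by funext j; simp [choiceMatrix, h]⟩
    · funext j; simp [choiceMatrix, h]
  · intro hQ
    have : ∀ (i : Fin L.n) (h : (i : ℕ) < L.n₁ + L.n₂), ∃ l ∈ L.J i h,
        Q i = fun j => if j = l then 1 else 0 := by
      intro i h
      have := hQ i trivial
      change dite _ _ _ at this
      rwa [dif_pos h] at this
    choose ℓ hℓ h using this
    refine ⟨ℓ, hℓ, ?_⟩
    ext i j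
    by_cases hi : (i : ℕ) < L.n₁ + L.n₂
    · rw [h i hi]; simp [choiceMatrix, hi]
    · have := hQ i trivial
      change dite _ _ _ at this
      rw [dif_neg hi] at this
      rw [this]; simp [choiceMatrix, hi]

theorem exists_row_of_mem_Icc (i : Fin L.n) (h : (i : ℕ) < L.n₁ + L.n₂) {l l' : Fin L.n}
    (hl : l ∈ L.J i h) (hl' : l' ∈ L.J i h) (v : Fin L.n → ℝ) {z : ℝ} (hz : z ∈ Set.Icc (v l) (v l')) :
    ∃ w ∈ convexHull ℝ (L.rowSet i), z = ∑ j, w j * v j := by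
  rw [← segment_eq_Icc (hz.1.trans hz.2)] at hz
  obtain ⟨a, b, ha, hb, hab, rfl⟩ := hz
  have mem : ∀ l ∈ L.J i h, (fun j => if j = l then (1 : ℝ) else 0) ∈ convexHull ℝ (L.rowSet i) := by
    intro l hl
    refine subset_convexHull ℝ _ ?_
    change dite _ _ _
    rw [dif_pos h]
    exact ⟨l, hl, rfl⟩
  refine ⟨_, convex_convexHull ℝ _ (mem l hl) (mem l' hl') ha hb hab, ?_⟩
  simp [add_mul, Finset.sum_add_distrib]

/-- A mean value property. If l and l' are minimisers for x and y, then x_l - y_l ≤ min x - min y ≤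
x_l' - y_l', so the difference is a convex combination of two coordinates of x - y. For maxima the
two bounds change places. -/
theorem exists_row (x y : Fin L.n → ℝ) (i : Fin L.n) :
    ∃ w ∈ convexHull ℝ (L.rowSet i), L.rhs x i - L.rhs y i = ∑ j, w j * (x - y) j := by
  unfold rhs
  split_ifs with h h'
  · obtain ⟨l, hl, e⟩ := (L.J i h).exists_mem_eq_inf' (L.J_nonempty i h) x
    obtain ⟨l', hl', e'⟩ := (L.J i h).exists_mem_eq_inf' (L.J_nonempty i h) y
    have h₁ := Finset.inf'_le x hl'
    have h₂ := Finset.inf'_le y hl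
    rw [e] at h₁
    rw [e'] at h₂
    rw [e, e']
    exact L.exists_row_of_mem_Icc i h hl hl' (x - y) 
      (by simp only [Set.mem_Icc, Pi.sub_apply]; constructor <;> linarith)
  · obtain ⟨l, hl, e⟩ := (L.J i h).exists_mem_eq_sup' (L.J_nonempty i h) x
    obtain ⟨l', hl', e'⟩ := (L.J i h).exists_mem_eq_sup' (L.J_nonempty i h) y
    have h₁ := Finset.le_sup' x hl'
    have h₂ := Finset.le_sup' y hl
    rw [e] at h₁
    rw [e'] at h₂
    rw [e, e']
    exact L.exists_row_of_mem_Icc i h hl' hl (x - y) 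
      (by simp only [Set.mem_Icc, Pi.sub_apply]; constructor <;> linarith)
  · refine ⟨L.q i (not_lt.mp h), subset_convexHull ℝ _ ?_, ?_⟩
    · change dite _ _ _
      rw [dif_neg h]
    · simp [mul_sub]

theorem exists_mulVec (x y : Fin L.n → ℝ) :
    ∃ Q ∈ convexHull ℝ L.choiceMatrices, L.rhs x - L.rhs y = Q.mulVec (x - y) := by
  choose w hw h using L.exists_row x y
  refine ⟨Matrix.of w, ?_, ?_⟩
  · rw [choiceMatrices_eq]
    have := convexHull_pi (𝕜 := ℝ) (Set.univ) (fun i => L.rowSet i)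
    have h' : w ∈ convexHull ℝ (Set.pi Set.univ L.rowSet) := by
      rw [this]
      exact fun i _ => hw i
    exact h'
  · funext i
    exact h i

theorem finite_choiceMatrices : L.choiceMatrices.Finite := by
  have : L.choiceMatrices ⊆ Set.range L.choiceMatrix := by
    rintro Q ⟨ℓ, -, rfl⟩
    exact ⟨ℓ, rfl⟩
  exact (Set.finite_range _).subset this

theorem isCompact_hull : IsCompact (convexHull ℝ L.choiceMatrices) :=
  L.finite_choiceMatrices.isCompact_convexHull ℝ

variable {L}

/-- Iteration gives v = t^m Q^m v, which tends to 0. -/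
theorem eq_zero_of_smul_mulVec_eq (hL : L.Halting) {Q : Matrix (Fin L.n) (Fin L.n) ℝ}
    (hQ : Q ∈ convexHull ℝ L.choiceMatrices) {t : ℝ} (h₀ : 0 ≤ t) (h₁ : t ≤ 1)
    {v : Fin L.n → ℝ} (hv : t • Q.mulVec v = v) : v = 0 := by
  have hm : ∀ m : ℕ, t ^ m • (Q ^ m).mulVec v = v := by
    intro m
    induction m with
    | zero => simp
    | succ m ih =>
      rw [pow_succ', pow_succ', ← Matrix.mulVec_mulVec, mul_smul, ← Matrix.mulVec_smul, ih, hv]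
  have hlim : Tendsto (fun m : ℕ => (Q ^ m).mulVec v) atTop (𝓝 0) := by
    have hc : Continuous fun A : Matrix (Fin L.n) (Fin L.n) ℝ => A.mulVec v := by fun_prop
    have := (hc.tendsto 0).comp (hL Q hQ)
    simpa [Function.comp_def] using this
  have hlim' : Tendsto (fun m : ℕ => t ^ m • (Q ^ m).mulVec v) atTop (𝓝 0) := by
    refine squeeze_zero_norm (fun m => ?_) (tendsto_zero_iff_norm_tendsto_zero.mp hlim)
    rw [norm_smul, norm_pow, Real.norm_of_nonneg h₀]
    exact mul_le_of_le_one_left (norm_nonneg _) (pow_le_one₀ h₀ h₁)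
  simp only [hm] at hlim'
  exact tendsto_nhds_unique tendsto_const_nhds hlim'

/-- The norm of v - tQv is continuous and, by the preceding lemma, positive on the compact product
of [0, 1], the hull and the unit sphere; its minimum there is c, and scaling removes the
normalisation of v. -/
theorem exists_lower_bound (hL : L.Halting) : ∃ c > 0, ∀ t : ℝ, 0 ≤ t → t ≤ 1 →
    ∀ Q ∈ convexHull ℝ L.choiceMatrices, ∀ v : Fin L.n → ℝ,
      c * ‖v‖ ≤ ‖v - t • Q.mulVec v‖ := by
  let K : Set (ℝ × Matrix (Fin L.n) (Fin L.n) ℝ × (Fin L.n → ℝ)) :=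
    Set.Icc 0 1 ×ˢ (convexHull ℝ L.choiceMatrices ×ˢ Metric.sphere 0 1)
  have hK : IsCompact K := isCompact_Icc.prod (L.isCompact_hull.prod (isCompact_sphere 0 1))
  have hf : Continuous fun p : ℝ × Matrix (Fin L.n) (Fin L.n) ℝ × (Fin L.n → ℝ) =>
      ‖p.2.2 - p.1 • p.2.1.mulVec p.2.2‖ := by fun_prop
  obtain ⟨c, hc, hmin⟩ : ∃ c > 0, ∀ p ∈ K, c ≤ ‖p.2.2 - p.1 • p.2.1.mulVec p.2.2‖ := by
    -- For n = 0 the unit sphere is empty, and any positive constant will do.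
    rcases K.eq_empty_or_nonempty with h | h
    · exact ⟨1, one_pos, by simp [h]⟩
    · obtain ⟨p, hp, hmin⟩ := hK.exists_isMinOn h hf.continuousOn
      refine ⟨_, ?_, fun q hq => hmin hq⟩
      rw [gt_iff_lt, norm_pos_iff, sub_ne_zero]
      intro e
      have := eq_zero_of_smul_mulVec_eq hL hp.2.1 hp.1.1 hp.1.2 e.symm
      have hn : ‖p.2.2‖ = 1 := by simpa using hp.2.2
      rw [this] at hn
      simp at hn
  refine ⟨c, hc, fun t h₀ h₁ Q hQ v => ?_⟩
  by_cases hv : v = 0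
  · simp [hv]
  have hv' : 0 < ‖v‖ := norm_pos_iff.mpr hv
  have := hmin (t, Q, ‖v‖⁻¹ • v) ⟨⟨h₀, h₁⟩, hQ, by simp [norm_smul, hv'.ne']⟩
  simp only [Matrix.mulVec_smul, smul_comm t, ← smul_sub, norm_smul, norm_inv, norm_norm] at this
  rwa [le_inv_mul_iff₀ hv', mul_comm] at this

theorem exists_upper_bound (L : LEMM ℝ) : ∃ M > 0, ∀ Q ∈ convexHull ℝ L.choiceMatrices,
    ∀ v : Fin L.n → ℝ, ‖Q.mulVec v‖ ≤ M * ‖v‖ := by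
  have hf : Continuous fun p : Matrix (Fin L.n) (Fin L.n) ℝ × (Fin L.n → ℝ) =>
      p.1.mulVec p.2 := by fun_prop
  obtain ⟨M, hM⟩ := (L.isCompact_hull.prod
    (isCompact_sphere (0 : Fin L.n → ℝ) 1)).exists_bound_of_continuousOn hf.continuousOn
  refine ⟨max M 1, by simp, fun Q hQ v => ?_⟩
  by_cases hv : v = 0
  · simp [hv]
  have hv' : 0 < ‖v‖ := norm_pos_iff.mpr hv
  have := (hM (Q, ‖v‖⁻¹ • v) ⟨hQ, by simp [norm_smul, hv'.ne']⟩).trans (le_max_left M 1)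
  simp only [Matrix.mulVec_smul, norm_smul, norm_inv, norm_norm] at this
  rwa [inv_mul_le_iff₀ hv', mul_comm] at this

/-- The solution map S at parameter t is Lipschitz with constant 1/c. The equation at t + s says x =
S(s·rhs(x) + a), whose right-hand side is Lipschitz with constant sM/c < 1, so Banach's fixed point
theorem applies. -/
theorem solvable_step {c M : ℝ} (hc : 0 < c) (hM : 0 < M)
    (hlow : ∀ t : ℝ, 0 ≤ t → t ≤ 1 → ∀ Q ∈ convexHull ℝ L.choiceMatrices, ∀ v : Fin L.n → ℝ,
      c * ‖v‖ ≤ ‖v - t • Q.mulVec v‖)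
    (hup : ∀ Q ∈ convexHull ℝ L.choiceMatrices, ∀ v : Fin L.n → ℝ, ‖Q.mulVec v‖ ≤ M * ‖v‖)
    {t s : ℝ} (h₀ : 0 ≤ t) (h₁ : t ≤ 1) (hs : 0 ≤ s) (hsm : s * M / c < 1)
    (ht : ∀ a : Fin L.n → ℝ, ∃ x, x = t • L.rhs x + a) (a : Fin L.n → ℝ) :
    ∃ x, x = (t + s) • L.rhs x + a := by
  choose S hS using ht
  have hSlip : ∀ a a', c * ‖S a - S a'‖ ≤ ‖a - a'‖ := by
    intro a a'
    obtain ⟨Q, hQ, e⟩ := L.exists_mulVec (S a) (S a')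
    refine (hlow t h₀ h₁ Q hQ _).trans (le_of_eq ?_)
    rw [← e, smul_sub]
    congr 1
    have e₁ : t • L.rhs (S a) = S a - a := eq_sub_of_add_eq (hS a).symm
    have e₂ : t • L.rhs (S a') = S a' - a' := eq_sub_of_add_eq (hS a').symm
    rw [e₁, e₂]
    abel
  let G : (Fin L.n → ℝ) → (Fin L.n → ℝ) := fun x => S (s • L.rhs x + a)
  have hnn : 0 ≤ s * M / c := by positivity
  have hG : ContractingWith ⟨s * M / c, hnn⟩ G := by
    refine ⟨by exact_mod_cast hsm, LipschitzWith.of_dist_le_mul fun x y => ?_⟩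
    rw [dist_eq_norm, dist_eq_norm]
    obtain ⟨Q, hQ, e⟩ := L.exists_mulVec x y
    have h₁ := hSlip (s • L.rhs x + a) (s • L.rhs y + a)
    rw [add_sub_add_right_eq_sub, ← smul_sub, e, norm_smul, Real.norm_of_nonneg hs] at h₁
    have h₂ := h₁.trans (mul_le_mul_of_nonneg_left (hup Q hQ (x - y)) hs)
    change ‖G x - G y‖ ≤ s * M / c * ‖x - y‖
    rw [div_mul_eq_mul_div, le_div_iff₀ hc]
    linarith
  refine ⟨hG.fixedPoint G, ?_⟩
  have hfix : G (hG.fixedPoint G) = hG.fixedPoint G := hG.fixedPoint_isFixedPt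
  have := hS (s • L.rhs (hG.fixedPoint G) + a)
  change G (hG.fixedPoint G) = t • L.rhs (G (hG.fixedPoint G)) + _ at this
  rw [hfix] at this
  rw [add_smul, add_assoc]
  exact this

theorem Halting.existsUnique (hL : L.Halting) : ∃! x : Fin L.n → ℝ, L.IsFeasible x := by
  obtain ⟨c, hc, hlow⟩ := exists_lower_bound hL
  obtain ⟨M, hM, hup⟩ := L.exists_upper_bound
  -- With steps of length 1/N the contraction constant is M/(cN) < 1 at every stage, so N steps lead
  -- from 0 to 1.
  obtain ⟨N, hN⟩ := exists_nat_gt (M / c)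
  have hN₀ : (0 : ℝ) < N := lt_trans (by positivity) hN
  have hk : ∀ k : ℕ, k ≤ N → ∀ a : Fin L.n → ℝ, ∃ x, x = ((k : ℝ) / N) • L.rhs x + a := by
    intro k
    induction k with
    | zero => intro _ a; exact ⟨a, by simp⟩
    | succ k ih =>
      intro hk a
      have hle : (k : ℝ) / N ≤ 1 := by
        rw [div_le_one hN₀]
        exact_mod_cast (Nat.le_succ k).trans hk
      have := solvable_step hc hM hlow hup (t := (k : ℝ) / N) (s := 1 / N) (by positivity) hle
        (by positivity) (by rw [one_div_mul_eq_div, div_right_comm, div_lt_one hN₀]; exact hN)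
        (ih ((Nat.le_succ k).trans hk)) a
      rwa [← add_div, ← Nat.cast_succ] at this
  obtain ⟨x, hx⟩ := hk N le_rfl 0
  rw [div_self hN₀.ne', one_smul, add_zero] at hx
  refine ⟨x, (L.isFeasible_iff x).mpr hx, fun y hy => ?_⟩
  replace hy := (L.isFeasible_iff y).mp hy
  obtain ⟨Q, hQ, e⟩ := L.exists_mulVec y x
  rw [← hx, ← hy] at e
  have := hlow 1 zero_le_one le_rfl Q hQ (y - x)
  rw [one_smul, ← e, sub_self, norm_zero] at this
  have h₀ : ‖y - x‖ = 0 := le_antisymm (nonpos_of_mul_nonpos_right this hc) (norm_nonneg _)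
  rwa [norm_eq_zero, sub_eq_zero] at h₀

end LEMM

/-! ### Rationality and bit size of the solution -/

/-- A solution of a linear system with integer coefficients of absolute value at most `B`. -/
theorem exists_rat_of_mulVec_eq {n : ℕ} (Z : Matrix (Fin n) (Fin n) ℤ) (z : Fin n → ℤ)
    (x : Fin n → ℝ) (B : ℕ) (hZ : ∀ i j, |Z i j| ≤ B) (hz : ∀ i, |z i| ≤ B) (hdet : Z.det ≠ 0)
    (hx : (Z.map (Int.cast : ℤ → ℝ)).mulVec x = fun i => (z i : ℝ)) :
    ∃ q : Fin n → ℚ, (∀ j, x j = q j) ∧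
      ∀ j, (q j).num.natAbs ≤ n.factorial * B ^ n ∧ (q j).den ≤ n.factorial * B ^ n := by
  have hdet' : (Z.map (Int.cast : ℤ → ℝ)).det = (Z.det : ℝ) :=
    (RingHom.map_det (Int.castRingHom ℝ) Z).symm
  have bound : ∀ A : Matrix (Fin n) (Fin n) ℤ, (∀ i j, |A i j| ≤ B) →
      A.det.natAbs ≤ n.factorial * B ^ n := by
    intro A hA
    have := Matrix.det_le (A := A) (abv := AbsoluteValue.abs) (x := (B : ℤ)) hA
    rw [Fintype.card_fin, AbsoluteValue.abs_apply, nsmul_eq_mul] at this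
    zify
    exact_mod_cast this
  -- Cramer's rule, stated with integer determinants so that the determinant bound applies to both
  -- sides; passing to lowest terms can only shrink numerator and denominator.
  have hcr : ∀ j, (Z.det : ℝ) * x j = ((Z.updateCol j z).det : ℝ) := by
    intro j
    have h₁ : (Z.map (Int.cast : ℤ → ℝ)).adjugate.mulVec ((Z.map (Int.cast : ℤ → ℝ)).mulVec x) =
        (Z.det : ℝ) • x := by
      rw [Matrix.mulVec_mulVec, Matrix.adjugate_mul, hdet', Matrix.smul_mulVec, Matrix.one_mulVec]
    rw [hx, ← Matrix.cramer_eq_adjugate_mulVec] at h₁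
    have h₂ := congrFun h₁ j
    rw [Matrix.cramer_apply, Pi.smul_apply, smul_eq_mul] at h₂
    rw [← h₂]
    have : (Z.map (Int.cast : ℤ → ℝ)).updateCol j (fun i => (z i : ℝ)) =
        (Int.castRingHom ℝ).mapMatrix (Z.updateCol j z) := by
      ext i k
      by_cases hk : k = j
      · subst hk; simp
      · simp [Matrix.updateCol_ne hk]
    rw [this, ← RingHom.map_det]
    rfl
  refine ⟨fun j => Rat.divInt (Z.updateCol j z).det Z.det, fun j => ?_, fun j => ⟨?_, ?_⟩⟩
  · have : (Z.det : ℝ) ≠ 0 := by exact_mod_cast hdet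
    beta_reduce
    rw [Rat.divInt_eq_div, Rat.cast_div, Rat.cast_intCast, Rat.cast_intCast, eq_div_iff this, mul_comm, hcr]
  · have hb := bound (Z.updateCol j z) fun i k => by
      by_cases hk : k = j
      · subst hk; simpa using hz i
      · simpa [Matrix.updateCol_ne hk] using hZ i k
    by_cases h0 : (Z.updateCol j z).det = 0
    · simp [h0]
    · exact (Nat.le_of_dvd (Int.natAbs_pos.mpr h0)
        (Int.natAbs_dvd_natAbs.mpr (Rat.num_dvd _ hdet))).trans hb
  · refine (Nat.le_of_dvd (Int.natAbs_pos.mpr hdet) ?_).trans (bound Z hZ)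
    exact Int.natCast_dvd.mp (Rat.den_dvd _ _)

open LEMMInstance

theorem size_le_length_encodeRat (r : ℚ) :
    r.num.natAbs.size + r.den.size ≤ (encodeRat r).length := by
  simp [encodeRat, ← Nat.size_eq_bits_len]
  lia

theorem den_le_two_pow (r : ℚ) : r.den ≤ 2 ^ (encodeRat r).length :=
  (Nat.lt_size_self _).le.trans (Nat.pow_le_pow_right (by lia)
    (by have := size_le_length_encodeRat r; lia))

theorem abs_le_two_pow (r : ℚ) : |r| ≤ 2 ^ (encodeRat r).length := by
  have h₁ : r.num.natAbs ≤ 2 ^ (encodeRat r).length :=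
    (Nat.lt_size_self _).le.trans (Nat.pow_le_pow_right (by lia)
      (by have := size_le_length_encodeRat r; lia))
  have h₂ : |r| ≤ r.num.natAbs := by
    conv_lhs => rw [← Rat.num_div_den r]
    rw [abs_div, Nat.abs_cast, Nat.cast_natAbs, Int.cast_abs]
    exact div_le_self (abs_nonneg _) (by exact_mod_cast r.den_pos)
  exact h₂.trans (by exact_mod_cast h₁)

namespace LEMM

variable (L : LEMM ℚ)

theorem length_encodeRow_le (I : LEMMInstance) (r : Fin I.L.n) :
    (encodeRow I.L r).length ≤ I.encode.length := by
  have h : (encodeRow I.L r).length ≤ ((List.finRange I.L.n).flatMap (encodeRow I.L)).length := by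
    rw [List.length_flatMap]
    exact List.single_le_sum (by simp) _ (List.mem_map.mpr ⟨r, List.mem_finRange r, rfl⟩)
  simp only [encode, List.length_append] at *
  lia

theorem n_le_length_encode (I : LEMMInstance) : I.L.n ≤ I.encode.length := by
  simp only [encode, encodeUnary, List.length_append, List.length_replicate]
  lia

/-- The coefficients of the linear system given by a choice. -/
def coeff (ℓ : ∀ i : Fin L.n, (i : ℕ) < L.n₁ + L.n₂ → Fin L.n) (i j : Fin L.n) : ℚ :=
  if h : (i : ℕ) < L.n₁ + L.n₂ then (if j = ℓ i h then 1 else 0) else L.q i (not_lt.mp h) j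

/-- The constants of the linear system given by a choice. -/
def inhom (i : Fin L.n) : ℚ :=
  if h : (i : ℕ) < L.n₁ + L.n₂ then 0 else L.b i (not_lt.mp h)

variable {L}

/-- For an affine row, D is the product of all its denominators. Each of them is at most 2 to the
length of its own code, and these lengths add up to the length of the row, so the product is still
at most 2^N. -/
theorem exists_common_denominator (ℓ : ∀ i : Fin L.n, (i : ℕ) < L.n₁ + L.n₂ → Fin L.n)
    {N : ℕ} (i : Fin L.n) (hN : (encodeRow L i).length ≤ N) :
    ∃ D : ℕ, 0 < D ∧ D ≤ 2 ^ N ∧ (∀ j, ∃ z : ℤ, (z : ℚ) = D * L.coeff ℓ i j) ∧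
      (∃ z : ℤ, (z : ℚ) = D * L.inhom i) ∧ (∀ j, |L.coeff ℓ i j| ≤ 2 ^ N) ∧ |L.inhom i| ≤ 2 ^ N := by
  by_cases h : (i : ℕ) < L.n₁ + L.n₂
  · have h1 : (1 : ℚ) ≤ 2 ^ N := one_le_pow₀ (by norm_num)
    refine ⟨1, one_pos, Nat.one_le_two_pow, fun j => ?_, ⟨0, by simp [inhom, h]⟩, fun j => ?_, ?_⟩
    · by_cases hj : j = ℓ i h
      · exact ⟨1, by simp [coeff, h, hj]⟩
      · exact ⟨0, by simp [coeff, h, hj]⟩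
    · by_cases hj : j = ℓ i h
      · simpa [coeff, h, hj] using h1
      · simp [coeff, h, hj]
    · simp [inhom, h]
  · have hc : ∀ j, L.coeff ℓ i j = L.q i (not_lt.mp h) j := fun j => by simp [coeff, h]
    have hb : L.inhom i = L.b i (not_lt.mp h) := by simp [inhom, h]
    have hlen : ∑ j, (encodeRat (L.coeff ℓ i j)).length + (encodeRat (L.inhom i)).length ≤ N := by
      refine le_of_eq_of_le ?_ hN
      simp only [hc, hb, encodeRow, dif_neg h, List.length_append, List.length_flatMap,
        Fin.sum_univ_def]
    have hint : ∀ (q : ℚ) (D : ℕ), q.den ∣ D → ∃ z : ℤ, (z : ℚ) = D * q := by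
      rintro q D ⟨k, rfl⟩
      refine ⟨k * q.num, ?_⟩
      push_cast
      rw [mul_comm (q.den : ℚ), mul_assoc, Rat.den_mul_eq_num]
    have hle : ∀ {m : ℕ}, m ≤ N → (2 : ℚ) ^ m ≤ 2 ^ N := fun hm =>
      pow_le_pow_right₀ (by norm_num) hm
    have hj : ∀ j, (encodeRat (L.coeff ℓ i j)).length ≤ N := fun j =>
      (Finset.single_le_sum (f := fun j => (encodeRat (L.coeff ℓ i j)).length) (by simp)
        (Finset.mem_univ j)).trans (by lia)
    refine ⟨(∏ j, (L.coeff ℓ i j).den) * (L.inhom i).den, ?_, ?_, fun j => hint _ _ ?_,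
      hint _ _ (dvd_mul_left _ _), fun j => (abs_le_two_pow _).trans (hle (hj j)),
      (abs_le_two_pow _).trans (hle (by lia))⟩
    · exact Nat.mul_pos (Finset.prod_pos fun j _ => Rat.den_pos _) (Rat.den_pos _)
    · refine le_trans ?_ (Nat.pow_le_pow_right (by lia) hlen)
      rw [pow_add, ← Finset.prod_pow_eq_pow_sum]
      exact Nat.mul_le_mul (Finset.prod_le_prod' fun j _ => den_le_two_pow _) (den_le_two_pow _)
    · exact (Finset.dvd_prod_of_mem _ (Finset.mem_univ j)).mul_right _

theorem cast_coeff (ℓ : ∀ i : Fin L.n, (i : ℕ) < L.n₁ + L.n₂ → Fin L.n) (i j : Fin L.n) :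
    (L.coeff ℓ i j : ℝ) = L.toReal.choiceMatrix ℓ i j := by
  by_cases h : (i : ℕ) < L.n₁ + L.n₂
  · have h' : L.toReal.choiceMatrix ℓ i j = if j = ℓ i h then 1 else 0 := dif_pos h
    rw [h', coeff, dif_pos h]
    split_ifs <;> simp
  · have h' : L.toReal.choiceMatrix ℓ i j = (L.q i (not_lt.mp h) j : ℝ) := dif_neg h
    rw [h', coeff, dif_neg h]

/-- The choice takes a minimiser or maximiser at x, which turns the system into a linear one solved
by x. -/
theorem exists_choice {x : Fin L.n → ℝ} (hx : L.toReal.IsFeasible x) :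
    ∃ ℓ : ∀ i : Fin L.n, (i : ℕ) < L.n₁ + L.n₂ → Fin L.n, (∀ i h, ℓ i h ∈ L.J i h) ∧
      ∀ i, x i = ∑ j, (L.coeff ℓ i j : ℝ) * x j + L.inhom i := by
  obtain ⟨h₁, h₂, h₃⟩ := hx
  have : ∀ (i : Fin L.n) (h : (i : ℕ) < L.n₁ + L.n₂), ∃ l ∈ L.J i h, x i = x l := by
    intro i h
    by_cases h' : (i : ℕ) < L.n₁
    · obtain ⟨l, hl, e⟩ := (L.J i h).exists_mem_eq_inf' (L.J_nonempty i h) x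
      exact ⟨l, hl, (h₁ i h').trans e⟩
    · obtain ⟨l, hl, e⟩ := (L.J i h).exists_mem_eq_sup' (L.J_nonempty i h) x
      exact ⟨l, hl, (h₂ i (not_lt.mp h') h).trans e⟩
  choose ℓ hℓ e using this
  refine ⟨ℓ, hℓ, fun i => ?_⟩
  by_cases h : (i : ℕ) < L.n₁ + L.n₂
  · have h' : ∀ j, (L.coeff ℓ i j : ℝ) * x j = if j = ℓ i h then x j else 0 := by
      intro j
      rw [coeff, dif_pos h]
      split_ifs <;> simp
    simp [h', inhom, h, e i h]
  · have h' : x i = ∑ j, (L.q i (not_lt.mp h) j : ℝ) * x j + (L.b i (not_lt.mp h) : ℝ) :=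
      h₃ i (not_lt.mp h)
    simpa [coeff, inhom, h] using h'

/-- Multiplying row i of (I - Q)x = b by its common denominator D gives an integer system. Its
entries are at most D(1 + 2^N) ≤ 2^N · 2 · 2^N in absolute value, which explains the exponent 2N +
1. -/
theorem exists_rat_solution (hL : L.toReal.Halting) {x : Fin L.n → ℝ} (hx : L.toReal.IsFeasible x)
    {N : ℕ} (hN : ∀ i, (encodeRow L i).length ≤ N) :
    ∃ q : Fin L.n → ℚ, (∀ j, x j = q j) ∧
      ∀ j, (q j).num.natAbs ≤ L.n.factorial * (2 ^ (2 * N + 1)) ^ L.n ∧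
        (q j).den ≤ L.n.factorial * (2 ^ (2 * N + 1)) ^ L.n := by
  obtain ⟨ℓ, hℓ, hsol⟩ := exists_choice hx
  choose D hD₀ hD hZ hz hc hb using fun i => exists_common_denominator ℓ i (hN i)
  choose Z hZ using hZ
  choose z hz using hz
  have hN1 : (1 : ℚ) ≤ 2 ^ N := one_le_pow₀ (by norm_num)
  have hpow : (2 : ℚ) ^ (2 * N + 1) = 2 * (2 ^ N * 2 ^ N) := by ring
  have hmul : ∀ i (q : ℚ), |q| ≤ 2 * 2 ^ N → |(D i : ℚ) * q| ≤ 2 ^ (2 * N + 1) := by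
    intro i q hq
    rw [abs_mul, Nat.abs_cast, hpow]
    have h₁ : (D i : ℚ) ≤ 2 ^ N := by exact_mod_cast hD i
    calc (D i : ℚ) * |q| ≤ 2 ^ N * (2 * 2 ^ N) :=
          mul_le_mul h₁ hq (abs_nonneg _) (by positivity)
      _ = _ := by ring
  have hdiag : ∀ i j, ((((if i = j then (D i : ℤ) else 0) - Z i j : ℤ)) : ℚ) =
      D i * ((if i = j then 1 else 0) - L.coeff ℓ i j) := by
    intro i j
    push_cast
    rw [hZ, mul_sub]
    split_ifs <;> simp
  have hdiagR : ∀ i j, ((((if i = j then (D i : ℤ) else 0) - Z i j : ℤ)) : ℝ) =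
      D i * ((if i = j then 1 else 0) - (L.coeff ℓ i j : ℝ)) := by
    intro i j
    have := congrArg (Rat.cast : ℚ → ℝ) (hZ i j)
    push_cast at this ⊢
    rw [this, mul_sub]
    split_ifs <;> simp
  have hmv : ∀ (v : Fin L.n → ℝ) i,
      ((Matrix.of fun i j => (if i = j then (D i : ℤ) else 0) - Z i j).map
        (Int.cast : ℤ → ℝ)).mulVec v i = D i * (v i - ∑ j, (L.coeff ℓ i j : ℝ) * v j) := by
    intro v i
    simp only [Matrix.mulVec, dotProduct, Matrix.map_apply, Matrix.of_apply, hdiagR]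
    simp_rw [mul_assoc, sub_mul, ← Finset.mul_sum, Finset.sum_sub_distrib, ite_mul, one_mul, zero_mul,
      Finset.sum_ite_eq, Finset.mem_univ, if_true]
  refine exists_rat_of_mulVec_eq (Matrix.of fun i j => (if i = j then (D i : ℤ) else 0) - Z i j) z x
    (2 ^ (2 * N + 1)) (fun i j => ?_) (fun i => ?_) ?_ ?_
  · rw [Matrix.of_apply, ← Int.cast_le (R := ℚ), Int.cast_abs, hdiag]
    push_cast
    refine hmul i _ ((abs_sub _ _).trans ?_)
    have h₁ : |(if i = j then (1 : ℚ) else 0)| ≤ 1 := by split_ifs <;> simp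
    linarith [hc i j]
  · rw [← Int.cast_le (R := ℚ), Int.cast_abs, hz]
    push_cast
    refine hmul i _ ((hb i).trans ?_)
    linarith
  -- A kernel vector of the scaled matrix is a fixed vector of the choice matrix, hence zero by C1.
  · intro h0
    have h0' : ((Matrix.of fun i j => (if i = j then (D i : ℤ) else 0) - Z i j).map
        (Int.cast : ℤ → ℝ)).det = 0 := by
      have := RingHom.map_det (Int.castRingHom ℝ)
        (Matrix.of fun i j => (if i = j then (D i : ℤ) else 0) - Z i j)
      rw [h0, map_zero] at this
      exact this.symm
    obtain ⟨v, hv, hv0⟩ := Matrix.exists_mulVec_eq_zero_iff.mpr h0'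
    refine hv (eq_zero_of_smul_mulVec_eq hL (subset_convexHull ℝ _ ⟨ℓ, hℓ, rfl⟩)
      zero_le_one le_rfl ?_)
    refine funext fun (i : Fin L.n) => ?_
    have := congrFun hv0 i
    rw [hmv, Pi.zero_apply, mul_eq_zero, sub_eq_zero] at this
    rw [one_smul]
    rcases this with h | h
    · exact absurd (by exact_mod_cast h) (hD₀ i).ne'
    · simp only [cast_coeff] at h
      exact h.symm
  · funext i
    rw [hmv]
    have h₁ := hsol i
    have h₂ := congrArg (Rat.cast : ℚ → ℝ) (hz i)
    push_cast at h₂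
    rw [h₂]
    congr 1
    linarith

end LEMM

/-! ### Length of certificates and conclusion -/

namespace PolyProg

theorem length_writeTuple (t : Tuple) : (writeTuple t).length =
    t.1.1.size + t.1.2.1.size + t.1.2.2.size + t.2.1.size + t.2.2.size + 5 := by
  simp [writeTuple, bitString, ← Nat.size_eq_bits_len]
  lia

theorem length_writeTuple_tupleOf_le (q : ℚ) {E : ℕ} (h₁ : q.num.natAbs ≤ 2 ^ E)
    (h₂ : q.den ≤ 2 ^ E) : (writeTuple (tupleOf q)).length ≤ 5 * (E + 2) + 5 := by
  obtain ⟨-, -, k₁, k₂, k₃, k₄, k₅⟩ := (exists_canonical q).choose_spec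
  have hE : 1 ≤ 2 ^ E := Nat.one_le_two_pow
  have hp : 2 ^ (E + 2) = 4 * 2 ^ E := by ring
  have hs : ∀ m : ℕ, m ≤ 2 ^ E + 1 → m.size ≤ E + 2 := fun m hm => by
    rw [Nat.size_le]; lia
  rw [length_writeTuple]
  have := hs (tupleOf q).1.1 (k₁.trans (by lia))
  have := hs (tupleOf q).1.2.1 (k₂.trans (by lia))
  have := hs (tupleOf q).1.2.2 (k₃.le.trans (by lia))
  have := hs (tupleOf q).2.1 (k₄.trans (by lia))
  have := hs (tupleOf q).2.2 (k₅.trans (by lia))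
  lia

theorem length_certOf_le {n : ℕ} (q : Fin n → ℚ) {E : ℕ}
    (h : ∀ j, (q j).num.natAbs ≤ 2 ^ E ∧ (q j).den ≤ 2 ^ E) :
    (certOf q).length ≤ n * (5 * (E + 2) + 6) := by
  rw [certOf, writeCert, List.length_flatMap]
  refine (List.sum_le_card_nsmul _ (5 * (E + 2) + 6) fun m hm => ?_).trans (by simp)
  simp only [List.map_map, List.mem_map, List.mem_finRange, true_and] at hm
  obtain ⟨j, rfl⟩ := hm
  have := length_writeTuple_tupleOf_le (q j) (h j).1 (h j).2
  simp
  lia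

theorem exists_map_some_eq {α : Type} {l : List (Option α)} (h : none ∉ l) :
    ∃ w : List α, w.map some = l := by
  induction l with
  | nil => exact ⟨[], rfl⟩
  | cons a l ih =>
    simp only [List.mem_cons, not_or] at h
    obtain ⟨w, rfl⟩ := ih h.2
    cases a with
    | none => exact absurd rfl h.1
    | some a => exact ⟨a :: w, rfl⟩

theorem none_notMem_writeCert (T : List Tuple) : none ∉ writeCert T := by
  have h := notMem_bitString (a := none) rfl
  simp [writeCert, writeTuple, h]

/-- From n! ≤ n^n ≤ (2^N)^N the exponents add up to N² + (2N + 1)N = 3N² + N. -/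
theorem factorial_mul_pow_le {n N : ℕ} (h : n ≤ N) :
    n.factorial * (2 ^ (2 * N + 1)) ^ n ≤ 2 ^ (3 * N ^ 2 + N) := by
  calc n.factorial * (2 ^ (2 * N + 1)) ^ n ≤ (2 ^ N) ^ N * (2 ^ (2 * N + 1)) ^ N := by
        refine Nat.mul_le_mul ?_ (Nat.pow_le_pow_right (by positivity) h)
        refine (Nat.factorial_le_pow n).trans ?_
        exact (Nat.pow_le_pow_left (Nat.lt_two_pow_self.le.trans
          (Nat.pow_le_pow_right (by lia) h)) n).trans (Nat.pow_le_pow_right (by positivity) h)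
    _ = 2 ^ (3 * N ^ 2 + N) := by
        rw [← pow_mul, ← pow_mul, ← pow_add]
        ring_nf

/-- A bound for the length of certificates. -/
noncomputable def certBound : Polynomial ℕ := .X * (5 * (3 * .X ^ 2 + .X + 2) + 6)

/-- The same string serves both answers: `neg` affects only the threshold test, so membership in UP
and in coUP are the two instances of this statement. -/
theorem exists_certificate (I : LEMMInstance) (hI : I.L.toReal.Halting) :
    ∃ w : List LEMMSymbol, w.length ≤ certBound.eval I.encode.length ∧ ∀ neg w',
      verify neg (I.encode.map some ++ none :: w'.map some) = true ↔
        (neg = true ↔ ¬ lemmHaltingProblem.yes I) ∧ w' = w := by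
  obtain ⟨x, hx, huniq⟩ := hI.existsUnique
  obtain ⟨q, hq, hsize⟩ := LEMM.exists_rat_solution hI hx (LEMM.length_encodeRow_le I)
  have hxq : x = fun j => (q j : ℝ) := funext hq
  have hn := LEMM.n_le_length_encode I
  have hrows : ∀ r, I.L.RowHolds q r := (LEMM.isFeasible_toReal_iff I.L q).mp (hxq ▸ hx)
  have huniq' : ∀ y : Fin I.L.n → ℚ, (∀ r, I.L.RowHolds y r) → y = q := by
    intro y hy
    rw [← LEMM.isFeasible_toReal_iff] at hy
    have := (huniq _ hy).trans hxq
    funext j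
    exact_mod_cast congrFun this j
  have hyes : lemmHaltingProblem.yes I ↔ q I.i < I.β := by
    constructor
    · rintro ⟨y, hy, hlt⟩
      rw [huniq y hy] at hlt
      have hlt' : (q I.i : ℝ) < I.β := lt_of_eq_of_lt (hq I.i).symm hlt
      exact_mod_cast hlt'
    · intro h
      have h' : (q I.i : ℝ) < I.β := by exact_mod_cast h
      exact ⟨x, hx, lt_of_eq_of_lt (hq I.i) h'⟩
  obtain ⟨w, hw⟩ := exists_map_some_eq
    (none_notMem_writeCert ((List.finRange I.L.n).map fun r => tupleOf (q r)))
  refine ⟨w, ?_, fun neg w' => ?_⟩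
  · have h₁ := length_certOf_le q (E := 3 * I.encode.length ^ 2 + I.encode.length) fun j =>
      ⟨(hsize j).1.trans (factorial_mul_pow_le hn), (hsize j).2.trans (factorial_mul_pow_le hn)⟩
    rw [certOf, ← hw, List.length_map] at h₁
    refine (h₁.trans (Nat.mul_le_mul_right _ hn)).trans (le_of_eq ?_)
    simp [certBound]
  · rw [verify_iff, hyes]
    constructor
    · rintro ⟨y, hy, hi, hw'⟩
      obtain rfl := huniq' y hy
      refine ⟨hi, List.map_injective_iff.mpr (Option.some_injective _) ?_⟩
      rw [hw', hw]; rfl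
    · rintro ⟨hi, rfl⟩
      exact ⟨q, hrows, hi, hw⟩

theorem inUP : lemmHaltingProblem.InUP := by
  refine ⟨fun a => verify false (lemmHaltingProblem.encodePair a), certBound,
    (PT.verify false).nonempty_tm2 _, fun I hI => ?_⟩
  obtain ⟨w, hw, h⟩ := exists_certificate I hI
  have h' : ∀ w', verify false (lemmHaltingProblem.encodePair (I, w')) = true ↔
      (false = true ↔ ¬ lemmHaltingProblem.yes I) ∧ w' = w := h false
  refine ⟨fun hy => ⟨w, hw, fun w' => ?_⟩, fun hn w' => ?_⟩
  · rw [h']; simp [hy]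
  · rw [Bool.eq_false_iff, ne_eq, h']; simp [hn]

theorem inCoUP : lemmHaltingProblem.InCoUP := by
  refine ⟨fun a => verify true (lemmHaltingProblem.compl.encodePair a), certBound,
    (PT.verify true).nonempty_tm2 _, fun I hI => ?_⟩
  obtain ⟨w, hw, h⟩ := exists_certificate I hI
  have h' : ∀ w', verify true (lemmHaltingProblem.compl.encodePair (I, w')) = true ↔
      (true = true ↔ lemmHaltingProblem.compl.yes I) ∧ w' = w := h true
  refine ⟨fun hy => ⟨w, hw, fun w' => ?_⟩, fun hn w' => ?_⟩
  · exact (h' w').trans (by simp [hy])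
  · exact Bool.eq_false_iff.mpr fun e => hn (((h' w').mp e).1.mp rfl)

end PolyProg

theorem mainTheorem2 :
    (∀ L : LEMM ℝ, L.Halting → ∃! x : Fin L.n → ℝ, L.IsFeasible x) ∧
      lemmHaltingProblem.InUP ∧ lemmHaltingProblem.InCoUP :=
  ⟨fun _ hL => hL.existsUnique, PolyProg.inUP, PolyProg.inCoUP⟩
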